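/- Let $\Gamma$ be a group. All rings are associative, not necessarily unital, and graded by $\Gamma$, and all modules are graded by $\Gamma$. A ring $A$ is \emph{idempotent} if $A^2=A$. A left $A$-module $M$ is \emph{unital} if $AM=M$. Put $t_A(M)=\{m\in M: Am=0\}$; $M$ is \emph{torsion-free} if $t_A(M)=0$, and similarly on the right. A ring is torsion-free if it is torsion-free as a left and as a right module over itself; a bimodule is unital (torsion-free) if it is so on both sides. $A\text{-gr}$ (resp. $\text{gr-}A$) is the category of unital torsion-free graded left (resp. right) $A$-modules with degree-preserving $A$-linear maps. The suspension $M(\sigma)$ is given by $M(\sigma)_\tau=M_{\tau\sigma}$. An object $P$ of $A\text{-gr}$ is a \emph{graded generator} if for every $M\in A\text{-gr}$, every unital graded module $N$ and every nonzero degree-preserving $A$-linear $f:M\to N$ there are $\sigma\in\Gamma$ and a degree-preserving $A$-linear $g:P(\sigma)\to M$ with $f\circ g\ne0$; similarly for right modules. A \emph{graded functor} $A\text{-gr}\to B\text{-gr}$ is an additive functor commuting with all suspension functors. For left modules, $\mathrm{HOM}_A(M,N)=\bigoplus_\sigma \mathrm{HOM}_A(M,N)_\sigma$, where $\mathrm{HOM}_A(M,N)_\sigma$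 consists of the $A$-linear $f$ with $f(M_\tau)\subseteq N_{\tau\sigma}$ for all $\tau$ (for right modules, $f(M_\tau)\subseteq N_{\sigma\tau}$), and $\mathrm{END}=\mathrm{HOM}(M,M)$, with endomorphisms written on the side opposite to the scalars. If $M$ is an $(A,B)$-bimodule, $B\cdot\mathrm{HOM}_A(M,N)$ is the subgroup generated by the maps $bf$, $(bf)(m)=f(mb)$; similarly $\mathrm{HOM}_B(M_B,N_B)\cdot A$ is generated by the maps $fa$, $(fa)(m)=f(am)$. Let $A,B$ be idempotent torsion-free graded rings, ${}_AP_B$, ${}_BQ_A$ unital torsion-free graded bimodules, and $\mu:P\otimes_BQ\to A$, $\nu:Q\otimes_AP\to B$ surjective degree-preserving bimodule homomorphisms such that, with $(p,q)=\mu(p\otimes q)$ and $[q,p]=\nu(q\otimes p)$, one has $p'[q,p]=(p',q)p$ and $q'(p,q)=[q',p]q$ for all $p,p'\in P$, $q,q'\in Q$. Then: \begin{enumerate} \item ${}_AP$, $P_B$, ${}_BQ$, $Q_A$ are graded generators of $A\text{-gr}$, $\text{gr-}B$, $B\text{-gr}$, $\text{gr-}A$, respectively. \item The canonical maps given by multiplication,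 $A\to\mathrm{END}({}_BQ)$, $A\to\mathrm{END}(P_B)$, $B\to\mathrm{END}(Q_A)$, $B\to\mathrm{END}({}_AP)$, induce graded ring isomorphisms $A\cong A\cdot\mathrm{END}({}_BQ)$, $A\cong\mathrm{END}(P_B)\cdot A$, $B\cong\mathrm{END}(Q_A)\cdot B$, $B\cong B\cdot\mathrm{END}({}_AP)$. \item The functors $P\otimes_B- /t_A(P\otimes_B-):B\text{-gr}\to A\text{-gr}$ and $Q\otimes_A- /t_B(Q\otimes_A-):A\text{-gr}\to B\text{-gr}$ are graded functors and mutually inverse equivalences of categories. \item There are natural isomorphisms of functors, with degree-preserving components, $P\otimes_B- /t_A(P\otimes_B-)\cong A\cdot\mathrm{HOM}_B(Q,-)$ and $Q\otimes_A- /t_B(Q\otimes_A-)\cong B\cdot\mathrm{HOM}_A(P,-)$, given by $p\otimes l\mapsto(q\mapsto[q,p]l)$ and $q\otimes k\mapsto(p\mapsto(p,q)k)$. \item There are degree-preserving module isomorphisms \[{}_BQ\cong B\cdot\mathrm{HOM}_A(P,A)\quad\text{and}\quad Q\otimes_AA/t_B(Q\otimes_AA)\cong{}_BQ,\] \[Q_A\cong\mathrm{HOM}_B(P,B)\cdot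 A\quad\text{and}\quad B\otimes_BQ/t_A(B\otimes_BQ)\cong Q_A,\] \[{}_AP\cong A\cdot\mathrm{HOM}_B(Q,B)\quad\text{and}\quad P\otimes_BB/t_A(P\otimes_BB)\cong{}_AP,\] \[P_B\cong\mathrm{HOM}_A(Q,A)\cdot B\quad\text{and}\quad A\otimes_AP/t_B(A\otimes_AP)\cong P_B,\] where the isomorphisms in the first column are $q\mapsto(-,q)$, $q\mapsto[q,-]$, $p\mapsto[-,p]$, $p\mapsto(p,-)$, and those in the second column are induced by the module actions. (In the second and fourth lines the homomorphisms and the torsion parts are those of right modules.) \item $P\otimes_BQ$ and $Q\otimes_AP$, with their usual $\Gamma$-gradings, are graded rings under the (well-defined) multiplications \[(p_1\otimes q_1)(p_2\otimes q_2)=p_1\otimes[q_1,p_2]q_2,\qquad(q_1\otimes p_1)(q_2\otimes p_2)=q_1(p_1,q_2)\otimes p_2.\] \end{enumerate} -/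

import Mathlib

open CategoryTheory MulOpposite
open scoped TensorProduct

universe w u

/-! ## Modules over non-unital rings -/

/-- A left module over a (not necessarily unital) ring. A right `R`-module is a module over
`Rᵐᵒᵖ`, the element `m r` being written `op r • m`. -/
class NUModule (R : Type*) (M : Type*) [NonUnitalRing R] [AddCommGroup M] extends
    DistribSMul R M where
  add_smul' : ∀ (r s : R) (m : M), (r + s) • m = r • m + s • m
  mul_smul' : ∀ (r s : R) (m : M), (r * s) • m = r • s • m

namespace NUModule

variable {R M : Type*} [NonUnitalRing R] [AddCommGroup M] [NUModule R M]

/-- The action as a biadditive map. -/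
def act : R →+ M →+ M :=
  AddMonoidHom.mk' (fun r => DistribSMul.toAddMonoidHom M r)
    (fun r s => AddMonoidHom.ext fun m => add_smul' r s m)

@[simp] theorem act_apply (r : R) (m : M) : act r m = r • m := rfl

variable (R M) in
/-- The additive subgroup `R M` generated by all products `r m`. -/
def smulSpan : AddSubgroup M := AddSubgroup.closure {x | ∃ (r : R) (m : M), x = r • m}

variable (R M) in
/-- The torsion part `{m | R m = 0}`. -/
def torsion : AddSubgroup M where
  carrier := {m | ∀ r : R, r • m = 0}
  zero_mem' := fun r => smul_zero r
  add_mem' := fun {a b} ha hb r => by rw [smul_add, ha r, hb r, add_zero]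
  neg_mem' := fun {a} ha r => by
    have := (act r : M →+ M).map_neg a
    simp only [act_apply] at this
    rw [this, ha r, neg_zero]

end NUModule

open NUModule

/-- The regular left module. -/
@[reducible] def NUModule.regular (R : Type*) [NonUnitalRing R] : NUModule R R where
  smul r s := r * s
  smul_zero := mul_zero
  smul_add := mul_add
  add_smul' := add_mul
  mul_smul' := mul_assoc

/-- The regular right module. -/
@[reducible] def NUModule.regularRight (R : Type*) [NonUnitalRing R] : NUModule Rᵐᵒᵖ R where
  smul r s := s * r.unop
  smul_zero r := zero_mul r.unop
  smul_add r a b := add_mul a b r.unop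
  add_smul' r s m := mul_add m r.unop s.unop
  mul_smul' r s m := (mul_assoc m s.unop r.unop).symm

/-- A left `R`-module is a right module over the opposite ring. -/
@[reducible] def NUModule.opOp (R M : Type*) [NonUnitalRing R] [AddCommGroup M] [NUModule R M] :
    NUModule Rᵐᵒᵖᵐᵒᵖ M where
  smul r m := r.unop.unop • m
  smul_zero r := smul_zero r.unop.unop
  smul_add r a b := smul_add r.unop.unop a b
  add_smul' r s m := NUModule.add_smul' r.unop.unop s.unop.unop m
  mul_smul' r s m := NUModule.mul_smul' r.unop.unop s.unop.unop m

/-! ## Internal direct sums -/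

section Internal

variable {Γ : Type w} [DecidableEq Γ] {M : Type u} [AddCommGroup M] {G : Γ → AddSubgroup M}

/-- The isomorphism with the external direct sum. -/
noncomputable def DirectSum.IsInternal.sumEquiv (h : DirectSum.IsInternal G) :
    DirectSum Γ (fun i => G i) ≃+ M :=
  AddEquiv.ofBijective (DirectSum.coeAddMonoidHom G) (show Function.Bijective _ from h)

/-- The projection onto the component of degree `σ`, as an endomorphism. -/
noncomputable def DirectSum.IsInternal.comp (h : DirectSum.IsInternal G) (σ : Γ) : M →+ M :=
  (G σ).subtype.comp ((DFinsupp.evalAddMonoidHom σ).comp h.sumEquiv.symm.toAddMonoidHom)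

theorem DirectSum.IsInternal.symm_of_mem (h : DirectSum.IsInternal G) {σ : Γ} {x : M}
    (hx : x ∈ G σ) : h.sumEquiv.symm x = DirectSum.of (fun i => G i) σ ⟨x, hx⟩ := by
  rw [AddEquiv.symm_apply_eq]
  exact (DirectSum.coeAddMonoidHom_of G σ ⟨x, hx⟩).symm

theorem DirectSum.IsInternal.comp_same (h : DirectSum.IsInternal G) {σ : Γ} {x : M}
    (hx : x ∈ G σ) : h.comp σ x = x := by
  change ((h.sumEquiv.symm x σ : G σ) : M) = x
  rw [h.symm_of_mem hx, DirectSum.of_eq_same]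

theorem DirectSum.IsInternal.comp_ne (h : DirectSum.IsInternal G) {σ τ : Γ} {x : M}
    (hx : x ∈ G σ) (hne : σ ≠ τ) : h.comp τ x = 0 := by
  change ((h.sumEquiv.symm x τ : G τ) : M) = 0
  rw [h.symm_of_mem hx, DirectSum.of_eq_of_ne _ _ _ hne.symm]
  rfl

theorem DirectSum.IsInternal.induct (h : DirectSum.IsInternal G) {p : M → Prop} (x : M)
    (zero : p 0) (add : ∀ a b, p a → p b → p (a + b)) (hom : ∀ σ, ∀ a ∈ G σ, p a) : p x := by
  obtain ⟨y, rfl⟩ := h.2 x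
  induction y using DirectSum.induction_on with
  | zero => simpa using zero
  | of i y => simpa using hom i y.1 y.2
  | add a b ha hb => rw [map_add]; exact add _ _ ha hb

/-- A criterion for being an internal direct sum. -/
theorem isInternal_of_separated
    (hspan : ∀ x : M, x ∈ AddSubgroup.closure {y | ∃ σ, y ∈ G σ})
    (hsep : ∀ σ, ∀ y ∈ G σ, y ≠ 0 → ∃ (X : Type u) (_ : AddCommGroup X) (p : M →+ X),
      p y ≠ 0 ∧ ∀ τ, τ ≠ σ → ∀ z ∈ G τ, p z = 0) : DirectSum.IsInternal G := by
  constructor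
  · rw [injective_iff_map_eq_zero]
    intro y hy
    refine DFinsupp.ext fun σ => ?_
    by_contra hne
    have hne' : ((y σ : G σ) : M) ≠ 0 := fun h => hne (Subtype.ext h)
    obtain ⟨X, _, p, hp, hz⟩ := hsep σ _ (y σ).2 hne'
    apply hp
    have key : ∀ y : DirectSum Γ (fun i => G i),
        p (DirectSum.coeAddMonoidHom G y) = p ((y σ : G σ) : M) := by
      intro y
      induction y using DirectSum.induction_on with
      | zero => simp
      | of i y =>
        by_cases hi : i = σ
        · subst hi; simp
        · rw [DirectSum.coeAddMonoidHom_of, hz i hi _ y.2,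
            DirectSum.of_eq_of_ne _ _ _ (Ne.symm hi)]
          simp
      | add a b ha hb => rw [map_add, map_add, ha, hb, DirectSum.add_apply,
          AddSubgroup.coe_add, map_add]
    rw [← key, hy, map_zero]
  · intro x
    have := hspan x
    have hle : AddSubgroup.closure {y | ∃ σ, y ∈ G σ} ≤ (DirectSum.coeAddMonoidHom G).range := by
      rw [AddSubgroup.closure_le]
      rintro y ⟨σ, hy⟩
      exact ⟨DirectSum.of (fun i => G i) σ ⟨y, hy⟩, by simp⟩
    exact hle this

end Internal

/-! ## The tensor product over a non-unital ring -/

section Tens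

variable (R M N : Type*) [NonUnitalRing R] [AddCommGroup M] [AddCommGroup N]
  [NUModule Rᵐᵒᵖ M] [NUModule R N]

/-- The relations `m r ⊗ n = m ⊗ r n`. -/
def Tens.rel : AddSubgroup (M ⊗[ℤ] N) :=
  AddSubgroup.closure {x | ∃ (m : M) (r : R) (n : N),
    x = (op r • m) ⊗ₜ[ℤ] n - m ⊗ₜ[ℤ] (r • n)}

/-- The tensor product `M ⊗_R N` of a right module `M` and a left module `N`. -/
abbrev Tens : Type _ := (M ⊗[ℤ] N) ⧸ Tens.rel R M N

variable {M N}

/-- The pure tensor `m ⊗ n`. -/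
def Tens.tmul (m : M) (n : N) : Tens R M N := QuotientAddGroup.mk (m ⊗ₜ[ℤ] n)

variable {R}

theorem Tens.add_tmul (m m' : M) (n : N) :
    Tens.tmul R (m + m') n = Tens.tmul R m n + Tens.tmul R m' n := by
  simp only [Tens.tmul, TensorProduct.add_tmul, QuotientAddGroup.mk_add]

theorem Tens.tmul_add (m : M) (n n' : N) :
    Tens.tmul R m (n + n') = Tens.tmul R m n + Tens.tmul R m n' := by
  simp only [Tens.tmul, TensorProduct.tmul_add, QuotientAddGroup.mk_add]

theorem Tens.smul_tmul (m : M) (r : R) (n : N) :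
    Tens.tmul R (op r • m) n = Tens.tmul R m (r • n) := by
  rw [Tens.tmul, Tens.tmul, QuotientAddGroup.eq_iff_sub_mem]
  exact AddSubgroup.subset_closure ⟨m, r, n, rfl⟩

/-- The universal balanced biadditive map. -/
def Tens.mk : M →+ N →+ Tens R M N :=
  AddMonoidHom.mk' (fun m => AddMonoidHom.mk' (fun n => Tens.tmul R m n) (Tens.tmul_add m))
    (fun m m' => AddMonoidHom.ext fun n => Tens.add_tmul m m' n)

@[simp] theorem Tens.mk_apply (m : M) (n : N) :
    (Tens.mk : M →+ N →+ Tens R M N) m n = Tens.tmul R m n := rfl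

@[elab_as_elim]
theorem Tens.induct {p : Tens R M N → Prop} (x : Tens R M N) (zero : p 0)
    (add : ∀ a b, p a → p b → p (a + b)) (tmul : ∀ m n, p (Tens.tmul R m n)) : p x := by
  obtain ⟨y, rfl⟩ := QuotientAddGroup.mk_surjective x
  induction y using TensorProduct.induction_on with
  | zero => exact zero
  | tmul m n => exact tmul m n
  | add a b ha hb => exact add _ _ ha hb

/-- The universal property of `M ⊗_R N`. -/
def Tens.lift {X : Type*} [AddCommGroup X] (f : M →+ N →+ X)
    (hf : ∀ m (r : R) n, f (op r • m) n = f m (r • n)) : Tens R M N →+ X :=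
  QuotientAddGroup.lift (Tens.rel R M N)
    (TensorProduct.liftAddHom f (fun r m n => by simp)) (by
      rw [Tens.rel, AddSubgroup.closure_le]
      rintro _ ⟨m, r, n, rfl⟩
      simp [hf])

@[simp] theorem Tens.lift_tmul {X : Type*} [AddCommGroup X] (f : M →+ N →+ X)
    (hf : ∀ m (r : R) n, f (op r • m) n = f m (r • n)) (m : M) (n : N) :
    Tens.lift f hf (Tens.tmul R m n) = f m n := rfl

theorem Tens.hom_ext {X : Type*} [AddCommGroup X] {f g : Tens R M N →+ X}
    (h : ∀ m n, f (Tens.tmul R m n) = g (Tens.tmul R m n)) : f = g := by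
  refine DFunLike.ext _ _ fun x => ?_
  induction x using Tens.induct with
  | zero => simp
  | add a b ha hb => simp [ha, hb]
  | tmul m n => exact h m n

/-- The map `f ⊗ g`. -/
def Tens.map {M' N' : Type*} [AddCommGroup M'] [AddCommGroup N'] [NUModule Rᵐᵒᵖ M']
    [NUModule R N'] (f : M →+ M') (g : N →+ N') (hf : ∀ (r : R) m, f (op r • m) = op r • f m)
    (hg : ∀ (r : R) n, g (r • n) = r • g n) : Tens R M N →+ Tens R M' N' :=
  Tens.lift (((AddMonoidHom.compHom' g).comp Tens.mk).comp f) (fun m r n => by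
    simp [hf, hg, Tens.smul_tmul])

@[simp] theorem Tens.map_tmul {M' N' : Type*} [AddCommGroup M'] [AddCommGroup N']
    [NUModule Rᵐᵒᵖ M'] [NUModule R N'] (f : M →+ M') (g : N →+ N')
    (hf : ∀ (r : R) m, f (op r • m) = op r • f m) (hg : ∀ (r : R) n, g (r • n) = r • g n)
    (m : M) (n : N) : Tens.map f g hf hg (Tens.tmul R m n) = Tens.tmul R (f m) (g n) := rfl

variable (R M N)

/-- The left action on `M ⊗_R N` of a ring acting on the left of `M`:
`s (m ⊗ n) = s m ⊗ n`. -/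
@[reducible] def Tens.leftModule (S : Type*) [NonUnitalRing S] [NUModule S M]
    [SMulCommClass S Rᵐᵒᵖ M] : NUModule S (Tens R M N) where
  smul s := Tens.map (act s) (AddMonoidHom.id N) (fun r m => smul_comm s (op r) m) (fun _ _ => rfl)
  smul_zero _ := map_zero _
  smul_add _ := map_add _
  add_smul' r s x := DFunLike.congr_fun (f := Tens.map (act (r + s)) (AddMonoidHom.id N)
      (fun r' m => smul_comm (r + s) (op r') m) (fun _ _ => rfl))
    (g := Tens.map (act r) (AddMonoidHom.id N) (fun r' m => smul_comm r (op r') m) (fun _ _ => rfl)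
      + Tens.map (act s) (AddMonoidHom.id N) (fun r' m => smul_comm s (op r') m) (fun _ _ => rfl))
    (Tens.hom_ext fun m n =>
      (congrArg (fun z => Tens.tmul R z n) (NUModule.add_smul' r s m)).trans (Tens.add_tmul _ _ _))
    x
  mul_smul' r s x := DFunLike.congr_fun (f := Tens.map (act (r * s)) (AddMonoidHom.id N)
      (fun r' m => smul_comm (r * s) (op r') m) (fun _ _ => rfl))
    (g := (Tens.map (act r) (AddMonoidHom.id N) (fun r' m => smul_comm r (op r') m)
      (fun _ _ => rfl)).comp
        (Tens.map (act s) (AddMonoidHom.id N) (fun r' m => smul_comm s (op r') m) (fun _ _ => rfl)))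
    (Tens.hom_ext fun m n => congrArg (fun z => Tens.tmul R z n) (NUModule.mul_smul' r s m)) x

/-- The right action on `M ⊗_R N` of a ring acting on the right of `N`:
`(m ⊗ n) s = m ⊗ n s`. -/
@[reducible] def Tens.rightModule (S : Type*) [NonUnitalRing S] [NUModule Sᵐᵒᵖ N]
    [SMulCommClass R Sᵐᵒᵖ N] : NUModule Sᵐᵒᵖ (Tens R M N) where
  smul s := Tens.map (AddMonoidHom.id M) (act s) (fun _ _ => rfl)
    (fun r n => (smul_comm r s n).symm)
  smul_zero _ := map_zero _
  smul_add _ := map_add _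
  add_smul' r s x := DFunLike.congr_fun (f := Tens.map (AddMonoidHom.id M) (act (r + s))
      (fun _ _ => rfl) (fun r' n => (smul_comm r' (r + s) n).symm))
    (g := Tens.map (AddMonoidHom.id M) (act r) (fun _ _ => rfl)
        (fun r' n => (smul_comm r' r n).symm)
      + Tens.map (AddMonoidHom.id M) (act s) (fun _ _ => rfl)
        (fun r' n => (smul_comm r' s n).symm))
    (Tens.hom_ext fun m n =>
      (congrArg (fun z => Tens.tmul R m z) (NUModule.add_smul' r s n)).trans (Tens.tmul_add _ _ _))
    x
  mul_smul' r s x := DFunLike.congr_fun (f := Tens.map (AddMonoidHom.id M) (act (r * s))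
      (fun _ _ => rfl) (fun r' n => (smul_comm r' (r * s) n).symm))
    (g := (Tens.map (AddMonoidHom.id M) (act r) (fun _ _ => rfl)
        (fun r' n => (smul_comm r' r n).symm)).comp
      (Tens.map (AddMonoidHom.id M) (act s) (fun _ _ => rfl)
        (fun r' n => (smul_comm r' s n).symm)))
    (Tens.hom_ext fun m n => congrArg (fun z => Tens.tmul R m z) (NUModule.mul_smul' r s n)) x

variable {R M N}

theorem Tens.map_smul_right {S N' : Type*} [NonUnitalRing S] [NUModule S M]
    [SMulCommClass S Rᵐᵒᵖ M] [AddCommGroup N'] [NUModule R N'] (g : N →+ N')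
    (hg : ∀ (r : R) n, g (r • n) = r • g n) (s : S) (x : Tens R M N) :
    let _ := Tens.leftModule R M N S
    let _ := Tens.leftModule R M N' S
    Tens.map (AddMonoidHom.id M) g (fun _ _ => rfl) hg (s • x) =
      s • Tens.map (AddMonoidHom.id M) g (fun _ _ => rfl) hg x := by
  intro _ _
  induction x using Tens.induct with
  | zero => simp only [smul_zero, map_zero]
  | add a b ha hb => simp only [smul_add, map_add, ha, hb]
  | tmul m n => rfl

end Tens

/-! ## Lemmas on gradings -/

section GradingLemmas

variable {Γ : Type w} [DecidableEq Γ]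

theorem isInternal_reindex {Γ' : Type w} [DecidableEq Γ'] {M : Type u} [AddCommGroup M]
    {G : Γ → AddSubgroup M} (h : DirectSum.IsInternal G) (f : Γ' ≃ Γ) :
    DirectSum.IsInternal (fun i => G (f i)) := by
  apply isInternal_of_separated
  · intro x
    refine h.induct x (zero_mem _) (fun a b => add_mem) fun σ a ha => ?_
    exact AddSubgroup.subset_closure ⟨f.symm σ, by simpa using ha⟩
  · intro σ y hy hne
    refine ⟨M, inferInstance, h.comp (f σ), by rwa [h.comp_same hy], fun τ hτ z hz => ?_⟩
    exact h.comp_ne hz (fun e => hτ (f.injective e))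

theorem isInternal_comap {M M' : Type u} [AddCommGroup M] [AddCommGroup M']
    {G : Γ → AddSubgroup M} (h : DirectSum.IsInternal G) (e : M' ≃+ M) :
    DirectSum.IsInternal (fun i => (G i).comap e.toAddMonoidHom) := by
  apply isInternal_of_separated
  · intro x
    rw [← e.symm_apply_apply x]
    refine h.induct (p := fun y => e.symm y ∈ _) (e x) (by simp)
      (fun a b ha hb => by rw [map_add]; exact add_mem ha hb) fun σ a ha => ?_
    exact AddSubgroup.subset_closure ⟨σ, by simpa using ha⟩
  · intro σ y hy hne
    refine ⟨M, inferInstance, (h.comp σ).comp e.toAddMonoidHom, ?_, fun τ hτ z hz => ?_⟩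
    · rw [AddMonoidHom.comp_apply, h.comp_same hy]
      simpa using hne
    · exact h.comp_ne hz hτ

variable [Group Γ] {R M N : Type u} [NonUnitalRing R] [AddCommGroup M] [AddCommGroup N]

/-- The projections of a graded module are compatible with the action. -/
theorem comp_smul [NUModule R N] {GR : Γ → AddSubgroup R} {GN : Γ → AddSubgroup N}
    (hN : DirectSum.IsInternal GN)
    (hs : ∀ {σ τ : Γ} {r : R} {n : N}, r ∈ GR σ → n ∈ GN τ → r • n ∈ GN (σ * τ))
    {ρ : Γ} {r : R} (hr : r ∈ GR ρ) (σ : Γ) (n : N) :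
    hN.comp (ρ * σ) (r • n) = r • hN.comp σ n := by
  refine hN.induct (p := fun n => hN.comp (ρ * σ) (r • n) = r • hN.comp σ n) n (by simp)
    (fun a b ha hb => by
    rw [smul_add, map_add, map_add, smul_add, ha, hb]) fun τ a ha => ?_
  by_cases h : τ = σ
  · subst h
    rw [hN.comp_same ha, hN.comp_same (hs hr ha)]
  · rw [hN.comp_ne ha h, smul_zero]
    exact hN.comp_ne (hs hr ha) (fun e => h (mul_left_cancel e))

/-- The grading of a tensor product: `(M ⊗_R N)_γ` is generated by the `m ⊗ n` with `m`
and `n` homogeneous, `deg m * deg n = γ`. -/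
def Tens.gr [NUModule Rᵐᵒᵖ M] [NUModule R N] (GM : Γ → AddSubgroup M) (GN : Γ → AddSubgroup N)
    (γ : Γ) : AddSubgroup (Tens R M N) :=
  AddSubgroup.closure {x | ∃ (σ τ : Γ) (m : M) (n : N), m ∈ GM σ ∧ n ∈ GN τ ∧ σ * τ = γ ∧
    x = Tens.tmul R m n}

theorem Tens.gr_internal [NUModule Rᵐᵒᵖ M] [NUModule R N] {GR : Γ → AddSubgroup R}
    {GM : Γ → AddSubgroup M} {GN : Γ → AddSubgroup N} (hR : DirectSum.IsInternal GR)
    (hM : DirectSum.IsInternal GM) (hN : DirectSum.IsInternal GN)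
    (hs : ∀ {σ τ : Γ} {m : M} {r : R}, m ∈ GM σ → r ∈ GR τ → op r • m ∈ GM (σ * τ))
    (hs' : ∀ {σ τ : Γ} {r : R} {n : N}, r ∈ GR σ → n ∈ GN τ → r • n ∈ GN (σ * τ)) :
    DirectSum.IsInternal (Tens.gr (R := R) GM GN) := by
  apply isInternal_of_separated
  · intro x
    induction x using Tens.induct with
    | zero => exact zero_mem _
    | add a b ha hb => exact add_mem ha hb
    | tmul m n =>
      refine hM.induct (p := fun m => Tens.tmul R m n ∈ _) m ?_ ?_ fun σ m hm => ?_
      · exact (congrArg (· ∈ _) (map_zero (Tens.mk.flip n))).mpr (zero_mem _)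
      · intro a b ha hb
        rw [Tens.add_tmul]
        exact add_mem ha hb
      · refine hN.induct (p := fun n => Tens.tmul R m n ∈ _) n ?_ ?_ fun τ n hn => ?_
        · exact (congrArg (· ∈ _) (map_zero (Tens.mk m))).mpr (zero_mem _)
        · intro a b ha hb
          rw [Tens.tmul_add]
          exact add_mem ha hb
        · exact AddSubgroup.subset_closure
            ⟨σ * τ, AddSubgroup.subset_closure ⟨σ, τ, m, n, hm, hn, rfl, rfl⟩⟩
  · intro γ
    let φ : DirectSum Γ (fun i => GM i) →+ (N →+ Tens R M N) :=
      DirectSum.toAddMonoid fun ρ =>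
        ((AddMonoidHom.compHom' (hN.comp (ρ⁻¹ * γ))).comp Tens.mk).comp (GM ρ).subtype
    let π₀ : M →+ N →+ Tens R M N := φ.comp hM.sumEquiv.symm.toAddMonoidHom
    have hπ₀ : ∀ {ρ : Γ} {m : M} (_ : m ∈ GM ρ) (n : N),
        π₀ m n = Tens.tmul R m (hN.comp (ρ⁻¹ * γ) n) := by
      intro ρ m hm n
      change φ (hM.sumEquiv.symm m) n = _
      rw [hM.symm_of_mem hm, DirectSum.toAddMonoid_of]
      rfl
    have hbal : ∀ m (r : R) n, π₀ (op r • m) n = π₀ m (r • n) := by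
      intro m r n
      refine hM.induct (p := fun m => π₀ (op r • m) n = π₀ m (r • n)) m (by simp)
        (fun a b ha hb => by simp only [smul_add, map_add, AddMonoidHom.add_apply, ha, hb])
        fun σ m hm => ?_
      refine hR.induct (p := fun r => π₀ (op r • m) n = π₀ m (r • n)) r ?_ ?_ fun τ r hr => ?_
      · have h1 : (op (0 : R)) • m = 0 := map_zero ((act : Rᵐᵒᵖ →+ M →+ M).flip m)
        have h2 : (0 : R) • n = 0 := map_zero ((act : R →+ N →+ N).flip n)
        rw [h1, h2]
        simp
      · intro a b ha hb
        rw [MulOpposite.op_add, NUModule.add_smul', NUModule.add_smul', map_add, map_add,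
          AddMonoidHom.add_apply, ha, hb]
      · rw [hπ₀ (hs hm hr), hπ₀ hm, Tens.smul_tmul, ← comp_smul hN hs' hr]
        congr 3
        group
    have hπ : ∀ {δ : Γ} (z : Tens R M N), z ∈ Tens.gr (R := R) GM GN δ →
        Tens.lift π₀ hbal z = if δ = γ then z else 0 := by
      intro δ z hz
      induction hz using AddSubgroup.closure_induction with
      | mem z hz =>
        obtain ⟨σ, τ, m, n, hm, hn, rfl, rfl⟩ := hz
        rw [Tens.lift_tmul, hπ₀ hm]
        split_ifs with h
        · rw [hN.comp_same]
          rw [← h]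
          simpa using hn
        · rw [hN.comp_ne hn]
          · exact map_zero (Tens.mk m)
          · rintro rfl
            exact h (by group)
      | zero => simp
      | add a b _ _ ha hb => rw [map_add, ha, hb]; split_ifs <;> simp
      | neg a _ ha => rw [map_neg, ha]; split_ifs <;> simp
    intro y hy hne
    refine ⟨Tens R M N, inferInstance, Tens.lift π₀ hbal, ?_, fun τ hτ z hz => ?_⟩
    · rw [hπ y hy, if_pos rfl]; exact hne
    · rw [hπ z hz, if_neg hτ]

theorem Tens.map_mem_gr {M' N' : Type u} [AddCommGroup M'] [AddCommGroup N'] [NUModule Rᵐᵒᵖ M]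
    [NUModule R N] [NUModule Rᵐᵒᵖ M'] [NUModule R N'] {GM : Γ → AddSubgroup M}
    {GN : Γ → AddSubgroup N} {GM' : Γ → AddSubgroup M'} {GN' : Γ → AddSubgroup N'}
    {f : M →+ M'} {g : N →+ N'} {hf : ∀ (r : R) m, f (op r • m) = op r • f m}
    {hg : ∀ (r : R) n, g (r • n) = r • g n} (hfm : ∀ {σ : Γ} {m : M}, m ∈ GM σ → f m ∈ GM' σ)
    (hgm : ∀ {σ : Γ} {n : N}, n ∈ GN σ → g n ∈ GN' σ) {γ : Γ} {x : Tens R M N}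
    (hx : x ∈ Tens.gr (R := R) GM GN γ) : Tens.map f g hf hg x ∈ Tens.gr (R := R) GM' GN' γ := by
  induction hx using AddSubgroup.closure_induction with
  | mem x hx =>
    obtain ⟨ρ, ρ', m, n, hm, hn, rfl, rfl⟩ := hx
    exact AddSubgroup.subset_closure ⟨ρ, ρ', f m, g n, hfm hm, hgm hn, rfl, rfl⟩
  | zero => rw [map_zero]; exact zero_mem _
  | add x y _ _ hx hy => rw [map_add]; exact add_mem hx hy
  | neg x _ hx => rw [map_neg]; exact neg_mem hx

/-- The action on the quotient by the torsion part. -/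
@[reducible] def NUModule.torsionQuot (R M : Type*) [NonUnitalRing R] [AddCommGroup M]
    [NUModule R M] : NUModule R (M ⧸ torsion R M) where
  smul r := QuotientAddGroup.map _ _ (act r) (fun m hm => by
    change r • m ∈ torsion R M
    rw [show r • m = 0 from hm r]
    exact zero_mem _)
  smul_zero _ := map_zero _
  smul_add _ := map_add _
  add_smul' r s x := by
    obtain ⟨m, rfl⟩ := QuotientAddGroup.mk_surjective x
    exact congrArg QuotientAddGroup.mk (NUModule.add_smul' r s m)
  mul_smul' r s x := by
    obtain ⟨m, rfl⟩ := QuotientAddGroup.mk_surjective x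
    exact congrArg QuotientAddGroup.mk (NUModule.mul_smul' r s m)

theorem NUModule.torsionQuot_internal [NUModule R N] {GR : Γ → AddSubgroup R}
    {GN : Γ → AddSubgroup N} (hR : DirectSum.IsInternal GR) (hN : DirectSum.IsInternal GN)
    (hs : ∀ {σ τ : Γ} {r : R} {n : N}, r ∈ GR σ → n ∈ GN τ → r • n ∈ GN (σ * τ)) :
    DirectSum.IsInternal
      (fun σ => (GN σ).map (QuotientAddGroup.mk' (torsion R N))) := by
  apply isInternal_of_separated
  · intro x
    obtain ⟨n, rfl⟩ := QuotientAddGroup.mk_surjective x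
    refine hN.induct (p := fun n => (n : N ⧸ torsion R N) ∈ _) n (zero_mem _)
      (fun a b ha hb => add_mem ha hb) fun σ a ha => ?_
    exact AddSubgroup.subset_closure ⟨σ, a, ha, rfl⟩
  · rintro σ _ ⟨n, hn, rfl⟩ hne
    have hnt : n ∉ torsion R N := fun h => hne ((QuotientAddGroup.eq_zero_iff n).2 h)
    obtain ⟨ρ, r, hr, hrn⟩ : ∃ ρ, ∃ r ∈ GR ρ, r • n ≠ 0 := by
      by_contra hcon
      push Not at hcon
      refine hnt fun r => hR.induct (p := fun r => r • n = 0) r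
        (map_zero ((act : R →+ N →+ N).flip n))
        (fun a b ha hb => by rw [NUModule.add_smul', ha, hb, add_zero]) hcon
    refine ⟨N, inferInstance, QuotientAddGroup.lift (torsion R N) ((hN.comp (ρ * σ)).comp (act r))
      (fun m hm => ?_), ?_, ?_⟩
    · change hN.comp (ρ * σ) (r • m) = 0
      rw [ show r • m = 0 from hm r, map_zero]
    · change hN.comp (ρ * σ) (r • n) ≠ 0
      rw [hN.comp_same (hs hr hn)]
      exact hrn
    · rintro τ hτ _ ⟨m, hm, rfl⟩
      change hN.comp (ρ * σ) (r • m) = 0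
      exact hN.comp_ne (hs hr hm) (fun e => hτ (mul_left_cancel e))

end GradingLemmas

/-! ## Graded rings, modules and bimodules -/

/-- An idempotent, not necessarily unital, `Γ`-graded ring. -/
structure IGrRing (Γ : Type w) [Group Γ] [DecidableEq Γ] : Type (max w (u + 1)) where
  carrier : Type u
  [ring : NonUnitalRing carrier]
  gr : Γ → AddSubgroup carrier
  internal : DirectSum.IsInternal gr
  mul_mem : ∀ {σ τ : Γ} {a b : carrier}, a ∈ gr σ → b ∈ gr τ → a * b ∈ gr (σ * τ)
  idem : AddSubgroup.closure {x | ∃ a b : carrier, x = a * b} = ⊤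

attribute [instance] IGrRing.ring

section Graded

variable {Γ : Type w} [Group Γ] [DecidableEq Γ]

namespace IGrRing

/-- Left and right torsion-free. -/
def TorsionFree (A : IGrRing.{w, u} Γ) : Prop :=
  (∀ x : A.carrier, (∀ a : A.carrier, a * x = 0) → x = 0) ∧
    (∀ x : A.carrier, (∀ a : A.carrier, x * a = 0) → x = 0)

/-- The opposite ring, graded by the opposite group. -/
def op (A : IGrRing.{w, u} Γ) : IGrRing.{w, u} Γᵐᵒᵖ where
  carrier := A.carrierᵐᵒᵖ
  gr σ := (A.gr σ.unop).comap (opAddEquiv (α := A.carrier)).symm.toAddMonoidHom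
  internal := isInternal_comap (isInternal_reindex A.internal opEquiv.symm) opAddEquiv.symm
  mul_mem := fun ha hb => A.mul_mem hb ha
  idem := by
    rw [eq_top_iff]
    rintro x -
    have : x.unop ∈ AddSubgroup.closure {x | ∃ a b : A.carrier, x = a * b} := by
      rw [A.idem]; trivial
    induction x using MulOpposite.rec' with
    | h x =>
    change x ∈ _ at this
    induction this using AddSubgroup.closure_induction with
    | mem x hx =>
      obtain ⟨a, b, rfl⟩ := hx
      exact AddSubgroup.subset_closure ⟨MulOpposite.op b, MulOpposite.op a, rfl⟩
    | zero => exact zero_mem _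
    | add a b _ _ ha hb => exact add_mem ha hb
    | neg a _ ha => exact neg_mem ha

theorem TorsionFree.op {A : IGrRing.{w, u} Γ} (h : A.TorsionFree) : A.op.TorsionFree :=
  ⟨fun x hx => unop_injective (h.2 x.unop fun a => op_injective (hx (MulOpposite.op a))),
    fun x hx => unop_injective (h.1 x.unop fun a => op_injective (hx (MulOpposite.op a)))⟩

end IGrRing

/-- A unital graded left `A`-module, i.e. an object of `A-GR`. The category `GR-A` of unital
graded right `A`-modules is `GrMod A.op`. -/
structure GrMod (A : IGrRing.{w, u} Γ) : Type (max w (u + 1)) where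
  carrier : Type u
  [addCommGroup : AddCommGroup carrier]
  [module : NUModule A.carrier carrier]
  gr : Γ → AddSubgroup carrier
  internal : DirectSum.IsInternal gr
  smul_mem : ∀ {σ τ : Γ} {a : A.carrier} {m : carrier},
    a ∈ A.gr σ → m ∈ gr τ → a • m ∈ gr (σ * τ)
  unital : smulSpan A.carrier carrier = ⊤

attribute [instance] GrMod.addCommGroup GrMod.module

namespace GrMod

variable {A : IGrRing.{w, u} Γ}

/-- Morphisms of `A-GR`: the `A`-linear maps which preserve degrees. -/
@[ext]
structure Hom (M N : GrMod A) : Type u where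
  toFun : M.carrier →+ N.carrier
  map_smul : ∀ (a : A.carrier) (m : M.carrier), toFun (a • m) = a • toFun m
  map_mem : ∀ {σ : Γ} {m : M.carrier}, m ∈ M.gr σ → toFun m ∈ N.gr σ

instance : Category.{u} (GrMod A) where
  Hom M N := Hom M N
  id M := ⟨AddMonoidHom.id _, fun _ _ => rfl, fun h => h⟩
  comp f g := ⟨g.toFun.comp f.toFun, fun a m => by simp [f.map_smul, g.map_smul],
    fun h => g.map_mem (f.map_mem h)⟩

/-- The underlying additive map of a morphism. -/
def fn {M N : GrMod A} (f : M ⟶ N) : M.carrier →+ N.carrier := Hom.toFun f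

theorem fn_smul {M N : GrMod A} (f : M ⟶ N) (a : A.carrier) (m : M.carrier) :
    fn f (a • m) = a • fn f m := Hom.map_smul f a m

theorem fn_mem {M N : GrMod A} (f : M ⟶ N) {σ : Γ} {m : M.carrier} (h : m ∈ M.gr σ) :
    fn f m ∈ N.gr σ := Hom.map_mem f h

@[simp] theorem fn_id (M : GrMod A) : fn (𝟙 M) = AddMonoidHom.id _ := rfl

@[simp] theorem fn_comp {M N K : GrMod A} (f : M ⟶ N) (g : N ⟶ K) :
    fn (f ≫ g) = (fn g).comp (fn f) := rfl

@[ext] theorem hom_ext' {M N : GrMod A} {f g : M ⟶ N} (h : fn f = fn g) : f = g := Hom.ext h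

instance (M N : GrMod A) : Zero (M ⟶ N) := ⟨⟨0, fun a m => by simp, fun _ => zero_mem _⟩⟩

instance (M N : GrMod A) : Add (M ⟶ N) :=
  ⟨fun f g => ⟨fn f + fn g, fun a m => by simp [fn_smul],
    fun h => add_mem (fn_mem f h) (fn_mem g h)⟩⟩

instance (M N : GrMod A) : Neg (M ⟶ N) :=
  ⟨fun f => ⟨-fn f, fun a m => by
    have := ((act a : N.carrier →+ N.carrier)).map_neg (fn f m)
    simp only [act_apply] at this
    simp [fn_smul, this], fun h => neg_mem (fn_mem f h)⟩⟩

instance (M N : GrMod A) : AddCommGroup (M ⟶ N) where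
  add_assoc f g h := hom_ext' (add_assoc (fn f) (fn g) (fn h))
  zero_add f := hom_ext' (zero_add (fn f))
  add_zero f := hom_ext' (add_zero (fn f))
  neg_add_cancel f := hom_ext' (neg_add_cancel (fn f))
  add_comm f g := hom_ext' (add_comm (fn f) (fn g))
  nsmul := nsmulRec
  zsmul := zsmulRec

@[simp] theorem fn_add {M N : GrMod A} (f g : M ⟶ N) : fn (f + g) = fn f + fn g := rfl

@[simp] theorem fn_zero {M N : GrMod A} : fn (0 : M ⟶ N) = 0 := rfl

instance : Preadditive (GrMod A) where
  homGroup := fun _ _ => inferInstance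
  add_comp _ _ _ f f' g := hom_ext' (AddMonoidHom.comp_add (fn g) (fn f) (fn f'))
  comp_add _ _ _ f g g' := hom_ext' (AddMonoidHom.add_comp (fn g) (fn g') (fn f))

/-- The suspension `M(σ)`, with `M(σ)_τ = M_{τσ}`. -/
def susp (M : GrMod A) (σ : Γ) : GrMod A where
  carrier := M.carrier
  gr τ := M.gr (τ * σ)
  internal := isInternal_reindex M.internal (Equiv.mulRight σ)
  smul_mem := fun ha hm => by rw [mul_assoc]; exact M.smul_mem ha hm
  unital := M.unital

/-- The property `t_A(M) = 0`. -/
def TorsionFree : ObjectProperty (GrMod A) := fun M =>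
  ∀ m : M.carrier, (∀ a : A.carrier, a • m = 0) → m = 0

/-- `P` generates `M`. -/
def Generates (P M : GrMod A) : Prop :=
  ∀ (N : GrMod A) (f : M ⟶ N), f ≠ 0 → ∃ (σ : Γ) (g : P.susp σ ⟶ M), g ≫ f ≠ 0

/-- `HOM_A(M, N)_σ`: the homomorphisms of degree `σ`. -/
def homDeg (M N : GrMod A) (σ : Γ) : AddSubgroup (M.carrier →+ N.carrier) where
  carrier := {f | (∀ (a : A.carrier) (m : M.carrier), f (a • m) = a • f m) ∧
    ∀ τ : Γ, ∀ m ∈ M.gr τ, f m ∈ N.gr (τ * σ)}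
  zero_mem' := ⟨fun a m => by simp, fun _ _ _ => zero_mem _⟩
  add_mem' := fun {f g} hf hg => ⟨fun a m => by simp [hf.1, hg.1],
    fun τ m hm => add_mem (hf.2 τ m hm) (hg.2 τ m hm)⟩
  neg_mem' := fun {f} hf => ⟨fun a m => by
    have := ((act a : N.carrier →+ N.carrier)).map_neg (f m)
    simp only [act_apply] at this
    simp [hf.1, this], fun τ m hm => neg_mem (hf.2 τ m hm)⟩

/-- `HOM_A(M, N) = ⨁_σ HOM_A(M, N)_σ`, inside the additive maps from `M` to `N`. -/
def HOM (M N : GrMod A) : AddSubgroup (M.carrier →+ N.carrier) := ⨆ σ, homDeg M N σ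

@[elab_as_elim]
theorem HOM_induct {M N : GrMod A} {p : ∀ f : M.carrier →+ N.carrier, f ∈ HOM M N → Prop}
    {f : M.carrier →+ N.carrier} (hf : f ∈ HOM M N)
    (mem : ∀ σ, ∀ f, ∀ h : f ∈ homDeg M N σ, p f (AddSubgroup.mem_iSup_of_mem σ h))
    (zero : p 0 (zero_mem _)) (add : ∀ f g hf hg, p f hf → p g hg → p (f + g) (add_mem hf hg)) :
    p f hf :=
  AddSubgroup.iSup_induction' (C := p) _ mem zero add hf

/-- The torsion-free quotient `M / t_A(M)`. -/
def modTorsion (M : GrMod A) : GrMod A where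
  carrier := M.carrier ⧸ torsion A.carrier M.carrier
  module := NUModule.torsionQuot A.carrier M.carrier
  gr σ := (M.gr σ).map (QuotientAddGroup.mk' (torsion A.carrier M.carrier))
  internal := torsionQuot_internal A.internal M.internal M.smul_mem
  smul_mem := by
    rintro σ τ a _ ha ⟨m, hm, rfl⟩
    exact ⟨a • m, M.smul_mem ha hm, rfl⟩
  unital := by
    let _ := NUModule.torsionQuot A.carrier M.carrier
    rw [eq_top_iff]
    rintro x -
    obtain ⟨m, rfl⟩ := QuotientAddGroup.mk_surjective x
    have : m ∈ smulSpan A.carrier M.carrier := by rw [M.unital]; trivial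
    induction this using AddSubgroup.closure_induction with
    | mem m hm =>
      obtain ⟨a, m, rfl⟩ := hm
      exact AddSubgroup.subset_closure ⟨a, QuotientAddGroup.mk m, rfl⟩
    | zero => exact zero_mem _
    | add a b _ _ ha hb => exact add_mem ha hb
    | neg a _ ha => exact neg_mem ha

theorem modTorsion_torsionFree (M : GrMod A) : TorsionFree M.modTorsion := by
  intro x hx
  obtain ⟨m, rfl⟩ := QuotientAddGroup.mk_surjective x
  refine (QuotientAddGroup.eq_zero_iff m).2 fun a => ?_
  have ha : a ∈ AddSubgroup.closure {x | ∃ a b : A.carrier, x = a * b} := by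
    rw [A.idem]; trivial
  induction ha using AddSubgroup.closure_induction with
  | mem c hc =>
    obtain ⟨a, b, rfl⟩ := hc
    rw [NUModule.mul_smul']
    exact ((QuotientAddGroup.eq_zero_iff (b • m)).1 (hx b)) a
  | zero => exact map_zero ((act : A.carrier →+ M.carrier →+ M.carrier).flip m)
  | add a b _ _ ha hb => rw [NUModule.add_smul', ha, hb, add_zero]
  | neg a _ ha =>
    have := map_neg ((act : A.carrier →+ M.carrier →+ M.carrier).flip m) a
    simp only [AddMonoidHom.flip_apply, act_apply] at this
    rw [this, ha, neg_zero]

end GrMod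

/-- The category `A-gr` of unital torsion-free graded left `A`-modules, a full subcategory of
`A-GR`. The category `gr-A` of unital torsion-free graded right modules is `A.op.Gr`. -/
abbrev IGrRing.Gr (A : IGrRing.{w, u} Γ) : Type (max w (u + 1)) :=
  (GrMod.TorsionFree (A := A)).FullSubcategory

namespace IGrRing

variable (A : IGrRing.{w, u} Γ)

/-- `M ↦ M / t_A(M)`. -/
def modTorsionFunctor : GrMod A ⥤ A.Gr where
  obj M := ⟨M.modTorsion, M.modTorsion_torsionFree⟩
  map {M N} f := ObjectProperty.homMk
    (show M.modTorsion ⟶ N.modTorsion from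
      { toFun := QuotientAddGroup.map _ _ (GrMod.fn f) (fun m hm a => by
          rw [← GrMod.fn_smul, show a • m = 0 from hm a, map_zero])
        map_smul := fun a x => by
          obtain ⟨m, rfl⟩ := QuotientAddGroup.mk_surjective x
          exact congrArg QuotientAddGroup.mk (GrMod.fn_smul f a m)
        map_mem := by
          rintro σ _ ⟨m, hm, rfl⟩
          exact ⟨GrMod.fn f m, GrMod.fn_mem f hm, rfl⟩ })
  map_id M := by
    apply ObjectProperty.hom_ext
    apply GrMod.hom_ext'
    refine DFunLike.ext _ _ fun x => ?_
    obtain ⟨m, rfl⟩ := QuotientAddGroup.mk_surjective x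
    rfl
  map_comp f g := by
    apply ObjectProperty.hom_ext
    apply GrMod.hom_ext'
    refine DFunLike.ext _ _ fun x => ?_
    obtain ⟨m, rfl⟩ := QuotientAddGroup.mk_surjective x
    rfl

/-- The suspension functor of `A-gr`. -/
def suspension (σ : Γ) : A.Gr ⥤ A.Gr where
  obj M := ⟨M.obj.susp σ, M.property⟩
  map {M N} f := ObjectProperty.homMk
    (show M.obj.susp σ ⟶ N.obj.susp σ from
      { toFun := GrMod.fn (M := M.obj) (N := N.obj) f.hom
        map_smul := GrMod.fn_smul (M := M.obj) (N := N.obj) f.hom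
        map_mem := fun h => GrMod.fn_mem (M := M.obj) (N := N.obj) f.hom h })
  map_id _ := rfl
  map_comp _ _ := rfl

/-- The ring `A` as a graded left module over itself. -/
def regularModule : GrMod A where
  carrier := A.carrier
  module := NUModule.regular A.carrier
  gr := A.gr
  internal := A.internal
  smul_mem := A.mul_mem
  unital := A.idem

variable {A} in
/-- A torsion-free ring as an object of `A-gr`. -/
def regularGr (hA : A.TorsionFree) : A.Gr := ⟨A.regularModule, hA.1⟩

end IGrRing

/-- An object of `A-gr` is a graded generator if it generates every object of `A-gr`. -/
def IsGradedGenerator {A : IGrRing.{w, u} Γ} (P : A.Gr) : Prop :=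
  ∀ M : A.Gr, P.obj.Generates M.obj

/-- A graded functor: additive and commuting with all suspensions. -/
def IsGradedFunctor {A B : IGrRing.{w, u} Γ} (F : A.Gr ⥤ B.Gr) : Prop :=
  F.Additive ∧ ∀ σ : Γ, A.suspension σ ⋙ F = F ⋙ B.suspension σ

/-- `F` and `G` are graded functors and mutually inverse equivalences of categories. -/
def AreInverseGradedEquivalences {A B : IGrRing.{w, u} Γ} (F : A.Gr ⥤ B.Gr) (G : B.Gr ⥤ A.Gr) :
    Prop :=
  IsGradedFunctor F ∧ IsGradedFunctor G ∧ Nonempty (F ⋙ G ≅ 𝟭 A.Gr) ∧ Nonempty (G ⋙ F ≅ 𝟭 B.Gr)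

/-- A graded `(A, B)`-bimodule which is unital on both sides. -/
structure GrBimod (A B : IGrRing.{w, u} Γ) : Type (max w (u + 1)) where
  carrier : Type u
  [addCommGroup : AddCommGroup carrier]
  [leftModule : NUModule A.carrier carrier]
  [rightModule : NUModule B.carrierᵐᵒᵖ carrier]
  [comm : SMulCommClass A.carrier B.carrierᵐᵒᵖ carrier]
  gr : Γ → AddSubgroup carrier
  internal : DirectSum.IsInternal gr
  smul_mem : ∀ {σ τ : Γ} {a : A.carrier} {m : carrier},
    a ∈ A.gr σ → m ∈ gr τ → a • m ∈ gr (σ * τ)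
  smul_mem' : ∀ {σ τ : Γ} {m : carrier} {b : B.carrier},
    m ∈ gr σ → b ∈ B.gr τ → op b • m ∈ gr (σ * τ)
  unital : smulSpan A.carrier carrier = ⊤
  unital' : smulSpan B.carrierᵐᵒᵖ carrier = ⊤

attribute [instance] GrBimod.addCommGroup GrBimod.leftModule GrBimod.rightModule
attribute [instance] GrBimod.comm

namespace GrBimod

variable {A B C : IGrRing.{w, u} Γ}

/-- The underlying left module. -/
@[reducible] def left (P : GrBimod A B) : GrMod A where
  carrier := P.carrier
  gr := P.gr
  internal := P.internal
  smul_mem := P.smul_mem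
  unital := P.unital

/-- An `(A, B)`-bimodule as a bimodule over the opposite rings `B.op` and `A.op`. -/
def op (P : GrBimod A B) : GrBimod B.op A.op where
  carrier := P.carrier
  leftModule := P.rightModule
  rightModule := NUModule.opOp A.carrier P.carrier
  comm :=
    let _ : NUModule B.op.carrier P.carrier := P.rightModule
    let _ : NUModule A.op.carrierᵐᵒᵖ P.carrier := NUModule.opOp A.carrier P.carrier
    ⟨fun b a m => (P.comm.smul_comm a.unop.unop b m).symm⟩
  gr σ := P.gr σ.unop
  internal := isInternal_reindex P.internal opEquiv.symm
  smul_mem := fun ha hm => P.smul_mem' hm ha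
  smul_mem' := fun hm hb => P.smul_mem hb hm
  unital := P.unital'
  unital' := by
    let _ := NUModule.opOp A.carrier P.carrier
    rw [eq_top_iff, ← P.unital, smulSpan, AddSubgroup.closure_le]
    rintro _ ⟨a, m, rfl⟩
    exact AddSubgroup.subset_closure ⟨MulOpposite.op (MulOpposite.op a), m, rfl⟩

/-- The underlying right module. -/
def right (P : GrBimod A B) : GrMod B.op := P.op.left

/-- Torsion-free on both sides. -/
def TorsionFree (P : GrBimod A B) : Prop :=
  GrMod.TorsionFree P.left ∧ GrMod.TorsionFree P.right

/-- The underlying left module as an object of `A-gr`. -/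
def leftGr (P : GrBimod A B) (hP : P.TorsionFree) : A.Gr := ⟨P.left, hP.1⟩

/-- The underlying right module as an object of `gr-B`. -/
def rightGr (P : GrBimod A B) (hP : P.TorsionFree) : B.op.Gr := ⟨P.right, hP.2⟩

/-- The regular bimodule. -/
def regular (A : IGrRing.{w, u} Γ) : GrBimod A A where
  carrier := A.carrier
  leftModule := NUModule.regular A.carrier
  rightModule := NUModule.regularRight A.carrier
  comm :=
    let _ := NUModule.regular A.carrier
    let _ := NUModule.regularRight A.carrier
    ⟨fun a b m => (mul_assoc a m b.unop).symm⟩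
  gr := A.gr
  internal := A.internal
  smul_mem := A.mul_mem
  smul_mem' := A.mul_mem
  unital := A.idem
  unital' := by
    let _ := NUModule.regularRight A.carrier
    rw [eq_top_iff, ← A.idem, AddSubgroup.closure_le]
    rintro _ ⟨a, b, rfl⟩
    exact AddSubgroup.subset_closure ⟨MulOpposite.op b, a, rfl⟩

/-- Graded homomorphisms of bimodules. -/
structure Hom (P Q : GrBimod A B) where
  toFun : P.carrier →+ Q.carrier
  map_smul : ∀ (a : A.carrier) (x : P.carrier), toFun (a • x) = a • toFun x
  map_smul' : ∀ (b : B.carrier) (x : P.carrier),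
    toFun (MulOpposite.op b • x) = MulOpposite.op b • toFun x
  map_mem : ∀ {σ : Γ} {x : P.carrier}, x ∈ P.gr σ → toFun x ∈ Q.gr σ

/-! ### Tensor products -/

/-- The graded left `A`-module `P ⊗_B L`. -/
def tensorObj (P : GrBimod A B) (L : GrMod B) : GrMod A where
  carrier := Tens B.carrier P.carrier L.carrier
  module := Tens.leftModule B.carrier P.carrier L.carrier A.carrier
  gr := Tens.gr P.gr L.gr
  internal := Tens.gr_internal B.internal P.internal L.internal P.smul_mem' L.smul_mem
  smul_mem := by
    let _ := Tens.leftModule B.carrier P.carrier L.carrier A.carrier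
    intro σ τ a x ha hx
    induction hx using AddSubgroup.closure_induction with
    | mem x hx =>
      obtain ⟨ρ, ρ', m, n, hm, hn, rfl, rfl⟩ := hx
      exact AddSubgroup.subset_closure
        ⟨σ * ρ, ρ', a • m, n, P.smul_mem ha hm, hn, mul_assoc _ _ _, rfl⟩
    | zero => rw [smul_zero]; exact zero_mem _
    | add x y _ _ hx hy => rw [smul_add]; exact add_mem hx hy
    | neg x _ hx => exact (congrArg (· ∈ _) (map_neg (act a) x)).mpr (neg_mem hx)
  unital := by
    let _ := Tens.leftModule B.carrier P.carrier L.carrier A.carrier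
    rw [eq_top_iff]
    rintro x -
    induction x using Tens.induct with
    | zero => exact zero_mem _
    | add a b ha hb => exact add_mem (ha) (hb)
    | tmul m n =>
      have hm : m ∈ smulSpan A.carrier P.carrier := by rw [P.unital]; trivial
      induction hm using AddSubgroup.closure_induction with
      | mem m hm =>
        obtain ⟨a, m, rfl⟩ := hm
        exact AddSubgroup.subset_closure ⟨a, Tens.tmul B.carrier m n, rfl⟩
      | zero => exact (congrArg (· ∈ _) (map_zero (Tens.mk.flip n))).mpr (zero_mem _)
      | add a b _ _ ha hb => rw [Tens.add_tmul]; exact add_mem ha hb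
      | neg a _ ha => exact (congrArg (· ∈ _) (map_neg (Tens.mk.flip n) a)).mpr (neg_mem ha)

/-- The functor `P ⊗_B -` from `B-GR` to `A-GR`. -/
def tensorFunctor (P : GrBimod A B) : GrMod B ⥤ GrMod A where
  obj L := P.tensorObj L
  map f :=
    { toFun := Tens.map (AddMonoidHom.id _) (GrMod.fn f) (fun _ _ => rfl) (GrMod.fn_smul f)
      map_smul := fun a x => Tens.map_smul_right (GrMod.fn f) (GrMod.fn_smul f) a x
      map_mem := fun hx => Tens.map_mem_gr (fun h => h) (GrMod.fn_mem f) hx }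
  map_id _ := GrMod.hom_ext' (Tens.hom_ext fun _ _ => rfl)
  map_comp _ _ := GrMod.hom_ext' (Tens.hom_ext fun _ _ => rfl)

/-- The functor `P ⊗_B - / t_A(P ⊗_B -)` from `B-gr` to `A-gr`. -/
def tensorModTorsion (P : GrBimod A B) : B.Gr ⥤ A.Gr :=
  (GrMod.TorsionFree (A := B)).ι ⋙ P.tensorFunctor ⋙ A.modTorsionFunctor

/-- The graded `(A, C)`-bimodule `P ⊗_B Q`. -/
def tensor (P : GrBimod A B) (Q : GrBimod B C) : GrBimod A C where
  carrier := Tens B.carrier P.carrier Q.carrier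
  leftModule := Tens.leftModule B.carrier P.carrier Q.carrier A.carrier
  rightModule := Tens.rightModule B.carrier P.carrier Q.carrier C.carrier
  comm :=
    let _ := Tens.leftModule B.carrier P.carrier Q.carrier A.carrier
    let _ := Tens.rightModule B.carrier P.carrier Q.carrier C.carrier
    ⟨fun a c x => by
      induction x using Tens.induct with
      | zero => simp only [smul_zero]
      | add x y hx hy => simp only [smul_add, hx, hy]
      | tmul m n => rfl⟩
  gr := Tens.gr P.gr Q.gr
  internal := (P.tensorObj Q.left).internal
  smul_mem := (P.tensorObj Q.left).smul_mem
  smul_mem' := by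
    let _ := Tens.rightModule B.carrier P.carrier Q.carrier C.carrier
    intro σ τ x c hx hc
    induction hx using AddSubgroup.closure_induction with
    | mem x hx =>
      obtain ⟨ρ, ρ', m, n, hm, hn, rfl, rfl⟩ := hx
      exact AddSubgroup.subset_closure ⟨ρ, ρ' * τ, m, MulOpposite.op c • n, hm,
        Q.smul_mem' hn hc, (mul_assoc _ _ _).symm, rfl⟩
    | zero => rw [smul_zero]; exact zero_mem _
    | add x y _ _ hx hy => rw [smul_add]; exact add_mem hx hy
    | neg x _ hx =>
      exact (congrArg (· ∈ _) (map_neg (act (MulOpposite.op c)) x)).mpr (neg_mem hx)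
  unital := (P.tensorObj Q.left).unital
  unital' := by
    let _ := Tens.rightModule B.carrier P.carrier Q.carrier C.carrier
    rw [eq_top_iff]
    rintro x -
    induction x using Tens.induct with
    | zero => exact zero_mem _
    | add a b ha hb => exact add_mem (ha) (hb)
    | tmul m n =>
      have hn : n ∈ smulSpan C.carrierᵐᵒᵖ Q.carrier := by rw [Q.unital']; trivial
      induction hn using AddSubgroup.closure_induction with
      | mem n hn =>
        obtain ⟨c, n, rfl⟩ := hn
        exact AddSubgroup.subset_closure ⟨c, Tens.tmul B.carrier m n, rfl⟩
      | zero => exact (congrArg (· ∈ _) (map_zero (Tens.mk m))).mpr (zero_mem _)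
      | add a b _ _ ha hb => rw [Tens.tmul_add]; exact add_mem ha hb
      | neg a _ ha => exact (congrArg (· ∈ _) (map_neg (Tens.mk m) a)).mpr (neg_mem ha)

/-- The pure tensor `p ⊗ q` in `P ⊗_B Q`. -/
def tmul (P : GrBimod A B) (Q : GrBimod B C) (p : P.carrier) (q : Q.carrier) :
    (P.tensor Q).carrier := Tens.tmul B.carrier p q

/-! ### Graded homomorphisms -/

/-- Right multiplication by `b`. -/
def rmul (P : GrBimod A B) (b : B.carrier) : P.carrier →+ P.carrier := act (MulOpposite.op b)

/-- The subgroup `B · HOM_A(P, N)` generated by the `b f`, where `(b f)(p) = f(p b)`. -/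
def smulHOM (P : GrBimod A B) (N : GrMod A) : AddSubgroup (P.carrier →+ N.carrier) :=
  AddSubgroup.closure {h | ∃ b : B.carrier, ∃ f ∈ GrMod.HOM P.left N, h = f.comp (P.rmul b)}

theorem comp_rmul_mem_homDeg (P : GrBimod A B) (N : GrMod A) {σ τ : Γ} {b : B.carrier}
    {f : P.carrier →+ N.carrier} (hb : b ∈ B.gr σ) (hf : f ∈ GrMod.homDeg P.left N τ) :
    f.comp (P.rmul b) ∈ GrMod.homDeg P.left N (σ * τ) := by
  refine ⟨fun a m => ?_, fun ρ m hm => ?_⟩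
  · change f (MulOpposite.op b • a • m) = a • f (MulOpposite.op b • m)
    rw [← smul_comm]
    exact hf.1 _ _
  · rw [← mul_assoc]
    exact hf.2 _ _ (P.smul_mem' hm hb)

theorem comp_rmul_mem_HOM (P : GrBimod A B) (N : GrMod A) (b : B.carrier)
    {f : P.left.carrier →+ N.carrier} (hf : f ∈ GrMod.HOM P.left N) :
    f.comp (P.rmul b) ∈ GrMod.HOM P.left N := by
  refine B.internal.induct (p := fun b => f.comp (P.rmul b) ∈ GrMod.HOM P.left N) b ?_ ?_ ?_
  · have : P.rmul (0 : B.carrier) = 0 := map_zero (act : B.carrierᵐᵒᵖ →+ P.carrier →+ P.carrier)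
    rw [this, AddMonoidHom.comp_zero]
    exact zero_mem _
  · intro a b ha hb
    have : P.rmul (a + b) = P.rmul a + P.rmul b :=
      map_add (act : B.carrierᵐᵒᵖ →+ P.carrier →+ P.carrier) _ _
    rw [this, AddMonoidHom.comp_add]
    exact add_mem ha hb
  · intro σ b hb
    induction hf using GrMod.HOM_induct with
    | mem τ f hf => exact AddSubgroup.mem_iSup_of_mem (σ * τ) (P.comp_rmul_mem_homDeg N hb hf)
    | zero => rw [AddMonoidHom.zero_comp]; exact zero_mem _
    | add f g _ _ hf hg => rw [AddMonoidHom.add_comp]; exact add_mem hf hg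

theorem smulHOM_le (P : GrBimod A B) (N : GrMod A) : P.smulHOM N ≤ GrMod.HOM P.left N := by
  rw [smulHOM, AddSubgroup.closure_le]
  rintro _ ⟨b, f, hf, rfl⟩
  exact P.comp_rmul_mem_HOM N b hf

/-- The left `B`-module structure of `B · HOM_A(P, N)`, with `(b f)(p) = f(p b)`. -/
@[reducible] def smulHOMModule (P : GrBimod A B) (N : GrMod A) :
    NUModule B.carrier (P.smulHOM N) where
  smul b f := ⟨f.1.comp (P.rmul b), AddSubgroup.subset_closure ⟨b, f.1, P.smulHOM_le N f.2, rfl⟩⟩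
  smul_zero _ := rfl
  smul_add _ _ _ := rfl
  add_smul' b c f := Subtype.ext (AddMonoidHom.ext fun p => by
    change f.1 (MulOpposite.op (b + c) • p) =
      f.1 (MulOpposite.op b • p) + f.1 (MulOpposite.op c • p)
    rw [MulOpposite.op_add, NUModule.add_smul', map_add])
  mul_smul' b c f := Subtype.ext (AddMonoidHom.ext fun p => by
    change f.1 (MulOpposite.op (b * c) • p) = f.1 (MulOpposite.op c • MulOpposite.op b • p)
    rw [MulOpposite.op_mul, NUModule.mul_smul'])

/-- The map `(b, f) ↦ b f`. -/
def smulHOMmk (P : GrBimod A B) (N : GrMod A) :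
    B.carrier →+ GrMod.HOM P.left N →+ P.smulHOM N :=
  AddMonoidHom.mk' (fun b => AddMonoidHom.mk'
      (fun f => ⟨f.1.comp (P.rmul b), AddSubgroup.subset_closure ⟨b, f.1, f.2, rfl⟩⟩)
      (fun _ _ => rfl))
    (fun b c => AddMonoidHom.ext fun f => Subtype.ext (AddMonoidHom.ext fun p => by
      change f.1 (MulOpposite.op (b + c) • p) =
        f.1 (MulOpposite.op b • p) + f.1 (MulOpposite.op c • p)
      rw [MulOpposite.op_add, NUModule.add_smul', map_add]))

theorem smulHOM_induct (P : GrBimod A B) (N : GrMod A) (S : AddSubgroup (P.smulHOM N))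
    (h : ∀ b f, P.smulHOMmk N b f ∈ S) (x : P.smulHOM N) : x ∈ S := by
  obtain ⟨x, hx⟩ := x
  induction hx using AddSubgroup.closure_induction with
  | mem x hx =>
    obtain ⟨b, f, hf, rfl⟩ := hx
    exact h b ⟨f, hf⟩
  | zero => exact zero_mem S
  | add a b _ _ ha hb => exact add_mem ha hb
  | neg a _ ha => exact neg_mem ha

theorem smulHOM_span (P : GrBimod A B) (N : GrMod A) (x : P.smulHOM N) :
    x ∈ AddSubgroup.closure {y : P.smulHOM N | ∃ σ,
      y ∈ (GrMod.homDeg P.left N σ).comap (P.smulHOM N).subtype} := by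
  refine P.smulHOM_induct N _ (fun b f => ?_) x
  refine B.internal.induct (p := fun b => P.smulHOMmk N b f ∈ _) b ?_ ?_ ?_
  · rw [map_zero]; exact zero_mem _
  · intro a b ha hb
    rw [map_add]; exact add_mem ha hb
  · intro σ b hb
    obtain ⟨f, hf⟩ := f
    induction hf using GrMod.HOM_induct with
    | mem τ f hf =>
      exact AddSubgroup.subset_closure ⟨σ * τ, P.comp_rmul_mem_homDeg N hb hf⟩
    | zero => exact (congrArg (· ∈ _) (map_zero (P.smulHOMmk N b))).mpr (zero_mem _)
    | add f g hf hg ihf ihg =>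
      exact (congrArg (· ∈ _) (map_add (P.smulHOMmk N b) ⟨f, hf⟩ ⟨g, hg⟩)).mpr (add_mem ihf ihg)

/-- The graded left `B`-module `B · HOM_A(P, N)`, with the grading induced from
`HOM_A(P, N)`. -/
def smulHOMObj (P : GrBimod A B) (N : GrMod A) : GrMod B where
  carrier := P.smulHOM N
  module := P.smulHOMModule N
  gr σ := (GrMod.homDeg P.left N σ).comap (P.smulHOM N).subtype
  internal := by
    apply isInternal_of_separated (P.smulHOM_span N)
    rintro σ ⟨f, hfm⟩ hf hne
    obtain ⟨τ, p, hp, hfp⟩ : ∃ τ, ∃ p ∈ P.gr τ, f p ≠ 0 := by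
      by_contra hcon
      push Not at hcon
      refine hne (Subtype.ext (AddMonoidHom.ext fun p => ?_))
      exact P.internal.induct (p := fun p => f p = 0) p (map_zero f)
        (fun a b ha hb => by rw [map_add, ha, hb, add_zero]) hcon
    refine ⟨N.carrier, inferInstance, (N.internal.comp (τ * σ)).comp
      ((AddMonoidHom.eval p).comp (P.smulHOM N).subtype), ?_, ?_⟩
    · change N.internal.comp (τ * σ) (f p) ≠ 0
      exact (N.internal.comp_same (hf.2 τ p hp)).trans_ne hfp
    · rintro ρ hρ ⟨g, hgm⟩ hg
      change N.internal.comp (τ * σ) (g p) = 0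
      exact N.internal.comp_ne (hg.2 τ p hp) (fun e => hρ (mul_left_cancel e))
  smul_mem := fun hb hf => P.comp_rmul_mem_homDeg N hb hf
  unital := by
    let _ := P.smulHOMModule N
    rw [eq_top_iff]
    rintro x -
    refine P.smulHOM_induct N _ (fun b f => ?_) x
    have hb : b ∈ AddSubgroup.closure {x | ∃ a b : B.carrier, x = a * b} := by
      rw [B.idem]; trivial
    induction hb using AddSubgroup.closure_induction with
    | mem b hb =>
      obtain ⟨c, d, rfl⟩ := hb
      refine AddSubgroup.subset_closure ⟨c, P.smulHOMmk N d f,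
        Subtype.ext (AddMonoidHom.ext fun p => ?_)⟩
      exact congrArg f.1 (NUModule.mul_smul' (MulOpposite.op d) (MulOpposite.op c) p)
    | zero => rw [map_zero]; exact zero_mem _
    | add a b _ _ ha hb => rw [map_add]; exact add_mem ha hb
    | neg a _ ha => rw [map_neg]; exact neg_mem ha

theorem smulHOMObj_torsionFree (P : GrBimod A B) (N : GrMod A) :
    GrMod.TorsionFree (P.smulHOMObj N) := by
  rintro ⟨f, hf⟩ h
  refine Subtype.ext (AddMonoidHom.ext fun p => ?_)
  have hp : p ∈ smulSpan B.carrierᵐᵒᵖ P.carrier := by rw [P.unital']; trivial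
  change f p = 0
  induction hp using AddSubgroup.closure_induction with
  | mem p hp =>
    obtain ⟨b, p, rfl⟩ := hp
    exact DFunLike.congr_fun (congrArg Subtype.val (h b.unop)) p
  | zero => exact map_zero f
  | add a b _ _ ha hb => rw [map_add, ha, hb, add_zero]
  | neg a _ ha => rw [map_neg, ha, neg_zero]

theorem comp_mem_smulHOM (P : GrBimod A B) {N N' : GrMod A} (g : N ⟶ N')
    {f : P.carrier →+ N.carrier} (hf : f ∈ P.smulHOM N) :
    (GrMod.fn g).comp f ∈ P.smulHOM N' := by
  induction hf using AddSubgroup.closure_induction with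
  | mem x hx =>
    obtain ⟨b, f, hf, rfl⟩ := hx
    refine AddSubgroup.subset_closure ⟨b, (GrMod.fn g).comp f, ?_, rfl⟩
    induction hf using GrMod.HOM_induct with
    | mem τ f hf =>
      refine AddSubgroup.mem_iSup_of_mem τ ⟨fun a m => ?_, fun ρ m hm => ?_⟩
      · change GrMod.fn g (f (a • m)) = a • GrMod.fn g (f m)
        rw [hf.1, GrMod.fn_smul]
      · exact GrMod.fn_mem g (hf.2 ρ m hm)
    | zero => rw [AddMonoidHom.comp_zero]; exact zero_mem _
    | add f f' _ _ hf hf' => rw [AddMonoidHom.comp_add]; exact add_mem hf hf'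
  | zero => rw [AddMonoidHom.comp_zero]; exact zero_mem _
  | add a b _ _ ha hb => rw [AddMonoidHom.comp_add]; exact add_mem ha hb
  | neg a _ ha =>
    have : (GrMod.fn g).comp (-a) = -(GrMod.fn g).comp a := by ext; simp
    rw [this]; exact neg_mem ha

/-- The functor `B · HOM_A(P, -)` from `A-gr` to `B-gr`; it acts on morphisms by composition. -/
def smulHOMFunctor (P : GrBimod A B) : A.Gr ⥤ B.Gr where
  obj N := ⟨P.smulHOMObj N.obj, P.smulHOMObj_torsionFree N.obj⟩
  map {N N'} g := ObjectProperty.homMk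
    (show P.smulHOMObj N.obj ⟶ P.smulHOMObj N'.obj from
      { toFun := AddMonoidHom.mk'
          (fun f => ⟨(GrMod.fn g.hom).comp f.1, P.comp_mem_smulHOM g.hom f.2⟩)
          (fun f f' => Subtype.ext (AddMonoidHom.comp_add _ _ _))
        map_smul := fun _ _ => rfl
        map_mem := fun {σ f} hf => ⟨fun a m => by
            change GrMod.fn g.hom (f.1 (a • m)) = a • GrMod.fn g.hom (f.1 m)
            rw [show f.1 (a • m) = a • f.1 m from hf.1 a m, GrMod.fn_smul],
          fun ρ m hm => GrMod.fn_mem g.hom (hf.2 ρ m hm)⟩ })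
  map_id _ := rfl
  map_comp _ _ := rfl

theorem comp_mem_smulHOM' (P : GrBimod A B) {f g : P.left.carrier →+ P.left.carrier}
    (hf : f ∈ GrMod.HOM P.left P.left) (hg : g ∈ P.smulHOM P.left) :
    f.comp g ∈ P.smulHOM P.left := by
  induction hg using AddSubgroup.closure_induction with
  | mem x hx =>
    obtain ⟨b, g, hg, rfl⟩ := hx
    refine AddSubgroup.subset_closure ⟨b, f.comp g, ?_, rfl⟩
    induction hg using GrMod.HOM_induct with
    | mem τ g hg =>
      induction hf using GrMod.HOM_induct with
      | mem σ f hf =>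
        refine AddSubgroup.mem_iSup_of_mem (τ * σ) ⟨fun a m => ?_, fun ρ m hm => ?_⟩
        · change f (g (a • m)) = a • f (g m)
          rw [hg.1, hf.1]
        · rw [← mul_assoc]
          exact hf.2 _ _ (hg.2 _ _ hm)
      | zero => rw [AddMonoidHom.zero_comp]; exact zero_mem _
      | add f f' _ _ hf hf' => rw [AddMonoidHom.add_comp]; exact add_mem hf hf'
    | zero => rw [AddMonoidHom.comp_zero]; exact zero_mem _
    | add g g' _ _ hg hg' => rw [AddMonoidHom.comp_add]; exact add_mem hg hg'
  | zero => rw [AddMonoidHom.comp_zero]; exact zero_mem _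
  | add a b _ _ ha hb => rw [AddMonoidHom.comp_add]; exact add_mem ha hb
  | neg a _ ha =>
    have : f.comp (-a) = -f.comp a := by ext; simp
    rw [this]; exact neg_mem ha

/-- The ring `B · END(_A P)`, as a subring of the ring of additive endomorphisms of `P` with
`(f * g)(p) = f(g(p))`. (Writing endomorphisms on the right of `P` gives the opposite ring.) -/
def smulEND (P : GrBimod A B) : NonUnitalSubring (AddMonoid.End P.carrier) where
  carrier := {f | (f : P.carrier →+ P.carrier) ∈ P.smulHOM P.left}
  zero_mem' := zero_mem (P.smulHOM P.left)
  add_mem' := fun {f g} hf hg => (P.smulHOM P.left).add_mem (x := f) (y := g) hf hg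
  neg_mem' := fun {f} hf => (P.smulHOM P.left).neg_mem (x := f) hf
  mul_mem' := fun {f g} hf hg => P.comp_mem_smulHOM' (P.smulHOM_le _ hf) hg

/-- The element `μ(p ⊗ q)` of `A`. -/
def Hom.pairing {P : GrBimod A B} {Q : GrBimod B A} (μ : Hom (P.tensor Q) (regular A))
    (p : P.carrier) (q : Q.carrier) : A.carrier := μ.toFun (P.tmul Q p q)

/-- The value at `p` of an element of `B · HOM_A(P, N)`. -/
def evalHOM (P : GrBimod A B) (N : A.Gr) (f : (P.smulHOMFunctor.obj N).obj.carrier)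
    (p : P.carrier) : N.obj.carrier :=
  (show P.smulHOM N.obj from f).1 p

/-- The class of `p ⊗ l` in `P ⊗_B L / t_A(P ⊗_B L)`. -/
def tmulMod (P : GrBimod A B) (L : B.Gr) (p : P.carrier) (l : L.obj.carrier) :
    (P.tensorModTorsion.obj L).obj.carrier :=
  (QuotientAddGroup.mk (Tens.tmul B.carrier p l : (P.tensorObj L.obj).carrier) :
    (P.tensorObj L.obj).carrier ⧸ torsion A.carrier (P.tensorObj L.obj).carrier)

/-- The canonical map `B → END(_A P)`, `b ↦ (p ↦ p b)`, induces an isomorphism of graded rings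
`B ≅ B · END(_A P)`, where endomorphisms of `_A P` are written on the right of `P`. -/
def RightCanonicalIso (P : GrBimod A B) : Prop :=
  ∃ e : B.carrier ≃+* (P.smulEND)ᵐᵒᵖ,
    (∀ (b : B.carrier) (p : P.carrier), (e b).unop.1 p = MulOpposite.op b • p) ∧
    ∀ (σ : Γ) (b : B.carrier), b ∈ B.gr σ ↔ (e b).unop.1 ∈ GrMod.homDeg P.left P.left σ

/-- The canonical map `A → END(P_B)`, `a ↦ (p ↦ a p)`, induces an isomorphism of graded rings
`A ≅ END(P_B) · A`, where endomorphisms of `P_B` are written on the left of `P`. -/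
def LeftCanonicalIso (P : GrBimod A B) : Prop :=
  ∃ e : A.carrier ≃+* P.op.smulEND,
    (∀ (a : A.carrier) (p : P.carrier), (e a).1 p = a • p) ∧
    ∀ (σ : Γ) (a : A.carrier), a ∈ A.gr σ ↔
      (e a).1 ∈ GrMod.homDeg P.right P.right (MulOpposite.op σ)

end GrBimod

/-- The biadditive map `m` is an associative multiplication which makes `M` a graded ring with
homogeneous components `gr σ`. -/
structure IsGradedRingMul {M : Type u} [AddCommGroup M] (gr : Γ → AddSubgroup M)
    (m : M →+ M →+ M) : Prop where
  internal : DirectSum.IsInternal gr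
  assoc : ∀ x y z : M, m (m x y) z = m x (m y z)
  mul_mem : ∀ {σ τ : Γ} {x y : M}, x ∈ gr σ → y ∈ gr τ → m x y ∈ gr (σ * τ)

/-- A graded Morita context `(A, B, P, Q, μ, ν)`. With `(p, q) = μ(p ⊗ q)` and
`[q, p] = ν(q ⊗ p)`, the two associativity conditions are `p' [q, p] = (p', q) p` and
`q' (p, q) = [q', p] q`. -/
structure GrMoritaContext {A B : IGrRing.{w, u} Γ} (P : GrBimod A B) (Q : GrBimod B A) where
  μ : GrBimod.Hom (P.tensor Q) (GrBimod.regular A)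
  ν : GrBimod.Hom (Q.tensor P) (GrBimod.regular B)
  assoc : ∀ (p p' : P.carrier) (q : Q.carrier), op (ν.pairing q p) • p' = μ.pairing p' q • p
  assoc' : ∀ (q q' : Q.carrier) (p : P.carrier), op (μ.pairing p q) • q' = ν.pairing q' p • q

end Graded

/-!
The pairings `(p, q) = μ(p ⊗ q)` and `[q, p] = ν(q ⊗ p)` take values which generate `A` and `B`.
Hence the following identities, in which `f` is an `A`-linear map on `P` and `Φ` is the canonical
map `Q ⊗_A N → B · HOM_A(P, N)`, `q ⊗ n ↦ (p ↦ (p, q) n)`, carry the whole proof: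

* `f(p' [q, p]) = (p', q) f(p)` (`MoritaPairing.comp_rmul_eq_hom`). It shows that `B · HOM_A(P, N)`
  is generated by the maps `p ↦ (p, q) n`, so that `Φ` is surjective; for `N = P` these maps are
  the right multiplications by `[q, p]`, which gives `B ≅ B · END_A(P)`, and for `N = A` they are
  the maps `(-, q a)`, which gives `Q ≅ B · HOM_A(P, A)`. Injectivity of these two isomorphisms is
  torsion-freeness of `B` and of `Q`.
* `[q, p] x = q ⊗ Φ(x)(p)` (`MoritaPairing.smul_tensor_eq`). It shows that the kernel of `Φ` is
  torsion, so that `Φ` induces an isomorphism `Q ⊗_A N / t_B(Q ⊗_A N) ≅ B · HOM_A(P, N)`.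
* `(p, q) x = p ⊗ (p' ↦ (p', q) ev(x))` (`MoritaPairing.smul_evalTensor_eq`), for the evaluation
  map `ev` from `P ⊗_B (B · HOM_A(P, N))` to `N`. It shows that the kernel of `ev` is torsion, so
  that `P ⊗_B -` and `Q ⊗_A -`, taken modulo torsion, are inverse equivalences.

The module `P` is a generator because every `N` is the sum of the images of the maps `p ↦ (p, q) n`,
which are morphisms from a suspension of `P` when `q` and `n` are homogeneous. The products on
`P ⊗_B Q` and `Q ⊗_A P` are well defined and associative because they equal `μ(x) y` and `ν(x) y`.

All of this is proved for left modules over one of the rings. The rest follows from the symmetry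
of the situation: `MoritaPairing.swap` exchanges the roles of `A` and `B`, and `MoritaPairing.op`
passes to the opposite rings, that is, from left modules to right modules.
-/

/-! ### Generating sets, bijective morphisms and torsion-free quotients -/

namespace NUModule

variable {R M : Type*} [NonUnitalRing R] [AddCommGroup M] [NUModule R M]

theorem zero_smul' (m : M) : (0 : R) • m = 0 := map_zero ((act : R →+ M →+ M).flip m)

theorem neg_smul' (r : R) (m : M) : (-r) • m = -(r • m) :=
  map_neg ((act : R →+ M →+ M).flip m) r

/-- If `S` generates `R` additively, then the products `s m` with `s ∈ S` generate `R M`. -/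
theorem smulSpan_induction {S : Set R} (hS : AddSubgroup.closure S = ⊤)
    (hM : smulSpan R M = ⊤) (H : AddSubgroup M) (h : ∀ s ∈ S, ∀ m : M, s • m ∈ H) (m : M) :
    m ∈ H := by
  have hm : m ∈ smulSpan R M := by rw [hM]; trivial
  refine (AddSubgroup.closure_le H).2 ?_ hm
  rintro _ ⟨r, m, rfl⟩
  have hr : r ∈ AddSubgroup.closure S := by rw [hS]; trivial
  induction hr using AddSubgroup.closure_induction with
  | mem r hr => exact h r hr m
  | zero => rw [zero_smul']; exact zero_mem H
  | add a b _ _ ha hb => rw [add_smul']; exact add_mem ha hb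
  | neg a _ ha => rw [neg_smul']; exact neg_mem ha

/-- An element is torsion as soon as it is annihilated by a generating set of the ring. -/
theorem mem_torsion_of_closure_eq_top {S : Set R} (hS : AddSubgroup.closure S = ⊤) {m : M}
    (h : ∀ s ∈ S, s • m = 0) : m ∈ torsion R M := by
  intro r
  have hr : r ∈ AddSubgroup.closure S := by rw [hS]; trivial
  induction hr using AddSubgroup.closure_induction with
  | mem r hr => exact h r hr
  | zero => exact zero_smul' m
  | add a b _ _ ha hb => rw [add_smul', ha, hb, add_zero]
  | neg a _ ha => rw [neg_smul', ha, neg_zero]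

end NUModule

/-- An injective additive map which preserves degrees also reflects them. -/
theorem DirectSum.IsInternal.mem_of_injective {Γ : Type w} [DecidableEq Γ] {M N : Type u}
    [AddCommGroup M] [AddCommGroup N] {G : Γ → AddSubgroup M} {H : Γ → AddSubgroup N}
    (hG : DirectSum.IsInternal G) (hH : DirectSum.IsInternal H) {f : M →+ N}
    (hf : Function.Injective f) (hmem : ∀ σ, ∀ x ∈ G σ, f x ∈ H σ) {σ : Γ} {x : M}
    (hx : f x ∈ H σ) : x ∈ G σ := by
  -- A degree-preserving map commutes with the projections onto the homogeneous components.
  have key : ∀ y, hH.comp σ (f y) = f (hG.comp σ y) := by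
    intro y
    refine hG.induct (p := fun y => hH.comp σ (f y) = f (hG.comp σ y)) y (by simp)
      (fun a b ha hb => by simp only [map_add, ha, hb]) fun τ a ha => ?_
    by_cases h : τ = σ
    · subst h
      rw [hH.comp_same (hmem _ a ha), hG.comp_same ha]
    · rw [hH.comp_ne (hmem _ a ha) h, hG.comp_ne ha h, map_zero]
  have h := key x
  rw [hH.comp_same hx] at h
  rw [hf h]
  exact (hG.sumEquiv.symm x σ).2

/-- Shifting the grading of `N` shifts the grading of `M ⊗_R N`, because the degree of `n` is the
right-hand factor of the degree of `m ⊗ n` and suspension multiplies degrees on the right. -/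
theorem Tens.gr_susp {Γ : Type w} [Group Γ] {R M N : Type u} [NonUnitalRing R] [AddCommGroup M]
    [AddCommGroup N] [NUModule Rᵐᵒᵖ M] [NUModule R N] (GM : Γ → AddSubgroup M)
    (GN : Γ → AddSubgroup N) (σ : Γ) :
    Tens.gr (R := R) GM (fun τ => GN (τ * σ)) = fun γ => Tens.gr (R := R) GM GN (γ * σ) := by
  funext γ
  refine congrArg AddSubgroup.closure (Set.ext fun x => ⟨?_, ?_⟩)
  · rintro ⟨ρ, τ, m, n, hm, hn, rfl, rfl⟩
    exact ⟨ρ, τ * σ, m, n, hm, hn, (mul_assoc _ _ _).symm, rfl⟩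
  · rintro ⟨ρ, τ, m, n, hm, hn, h, rfl⟩
    refine ⟨ρ, τ * σ⁻¹, m, n, hm, ?_, ?_, rfl⟩
    · simpa using hn
    · rw [← mul_assoc, h, mul_inv_cancel_right]

section Graded

variable {Γ : Type w} [Group Γ] [DecidableEq Γ] {A B : IGrRing.{w, u} Γ}

namespace GrMod

theorem hom_mem_iff {M N : GrMod A} (f : M ⟶ N) (hf : Function.Injective (fn f)) {σ : Γ}
    {m : M.carrier} : m ∈ M.gr σ ↔ fn f m ∈ N.gr σ :=
  ⟨fn_mem f, M.internal.mem_of_injective N.internal hf fun _ _ => fn_mem f⟩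

/-- A bijective morphism of graded modules is an isomorphism. -/
noncomputable def isoOfBijective {M N : A.Gr} (f : M.obj ⟶ N.obj)
    (hf : Function.Bijective (fn f)) : M ≅ N :=
  let e := AddEquiv.ofBijective (fn f) hf
  have he : ∀ n, fn f (e.symm n) = n := e.apply_symm_apply
  { hom := ObjectProperty.homMk f
    inv := ObjectProperty.homMk (show N.obj ⟶ M.obj from
      { toFun := e.symm.toAddMonoidHom
        map_smul := fun a n => hf.1 (by
          change fn f (e.symm _) = fn f (a • e.symm n)
          rw [he, fn_smul, he])
        map_mem := fun {σ n} hn => (hom_mem_iff f hf.1).2 (by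
          change fn f (e.symm n) ∈ _
          rwa [he]) })
    hom_inv_id := by
      apply ObjectProperty.hom_ext
      apply hom_ext'
      exact AddMonoidHom.ext e.symm_apply_apply
    inv_hom_id := by
      apply ObjectProperty.hom_ext
      apply hom_ext'
      exact AddMonoidHom.ext he }

/-- The morphism from `M / t_A(M)` induced by a morphism from `M` to a torsion-free module. -/
def modTorsionDesc {M N : GrMod A} (f : M ⟶ N) (hN : TorsionFree N) : M.modTorsion ⟶ N where
  toFun := QuotientAddGroup.lift (torsion A.carrier M.carrier) (fn f) fun m hm =>
    hN _ fun a => by rw [← fn_smul, show a • m = 0 from hm a, map_zero]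
  map_smul a x := by
    obtain ⟨m, rfl⟩ := QuotientAddGroup.mk_surjective x
    exact fn_smul f a m
  map_mem := by
    rintro σ _ ⟨m, hm, rfl⟩
    exact fn_mem f hm

/-- A surjection onto a torsion-free module whose kernel is torsion induces an isomorphism from
the torsion-free quotient. -/
noncomputable def modTorsionIso {M : GrMod A} {N : A.Gr} (f : M ⟶ N.obj)
    (hf : Function.Surjective (fn f)) (hker : ∀ m, fn f m = 0 → m ∈ torsion A.carrier M.carrier) :
    A.modTorsionFunctor.obj M ≅ N :=
  isoOfBijective (M := A.modTorsionFunctor.obj M) (modTorsionDesc f N.property) (by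
    constructor
    · refine (injective_iff_map_eq_zero _).2 fun x hx => ?_
      obtain ⟨m, rfl⟩ := QuotientAddGroup.mk_surjective x
      exact (QuotientAddGroup.eq_zero_iff m).2 (hker m hx)
    · intro n
      obtain ⟨m, rfl⟩ := hf n
      exact ⟨QuotientAddGroup.mk m, rfl⟩)

end GrMod

/-! ### Suspensions -/

namespace GrMod

/-- The suspension functor on all unital graded modules, torsion-free or not. -/
def suspFunctor (A : IGrRing.{w, u} Γ) (σ : Γ) : GrMod A ⥤ GrMod A where
  obj M := M.susp σ
  map {M N} f :=
    { toFun := fn (M := M) (N := N) f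
      map_smul := fn_smul (M := M) (N := N) f
      map_mem := fun h => fn_mem (M := M) (N := N) f h }

/-- Two graded modules with the same underlying module and equal gradings are equal. -/
theorem mk_congr {X : Type u} {_ : AddCommGroup X} {_ : NUModule A.carrier X}
    {g g' : Γ → AddSubgroup X} (h : g = g') (i i' s s' t) :
    (GrMod.mk X g i s t : GrMod A) = GrMod.mk X g' i' s' t := by
  subst h; rfl

theorem hom_heq {M M' N N' : GrMod A} (hM : M = M') (hN : N = N') {f : M ⟶ N} {f' : M' ⟶ N'}
    (h : HEq (fn f) (fn f')) : HEq f f' := by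
  subst hM hN
  exact heq_of_eq (hom_ext' (eq_of_heq h))

end GrMod

namespace GrBimod

theorem tensorObj_susp (P : GrBimod A B) (L : GrMod B) (σ : Γ) :
    P.tensorObj (L.susp σ) = (P.tensorObj L).susp σ :=
  GrMod.mk_congr (Tens.gr_susp P.gr L.gr σ) _ _ _ _ _

theorem fn_tensorFunctor_map (P : GrBimod A B) {L L' : GrMod B} (f : L ⟶ L') :
    GrMod.fn (P.tensorFunctor.map f) =
      (Tens.map (AddMonoidHom.id P.carrier) (GrMod.fn f) (fun _ _ => rfl) (GrMod.fn_smul f) :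
        Tens B.carrier P.carrier L.carrier →+ Tens B.carrier P.carrier L'.carrier) := rfl

theorem tensorFunctor_map_susp_heq (P : GrBimod A B) (σ : Γ) {L L' : GrMod B} (f : L ⟶ L') :
    HEq (P.tensorFunctor.map ((GrMod.suspFunctor B σ).map f))
      ((GrMod.suspFunctor A σ).map (P.tensorFunctor.map f)) :=
  GrMod.hom_heq (P.tensorObj_susp L σ) (P.tensorObj_susp L' σ)
    -- The underlying maps are definitionally equal; naming them keeps the type checker from
    -- comparing the gradings of the two sides, which are equal only propositionally.
    ((heq_of_eq (P.fn_tensorFunctor_map ((GrMod.suspFunctor B σ).map f))).trans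
      (heq_of_eq (P.fn_tensorFunctor_map f).symm))

/-- The two composites are equal, not only isomorphic: `P ⊗_B L(σ)` and `(P ⊗_B L)(σ)` have the same
underlying module, and the same homogeneous components by `Tens.gr_susp`. -/
theorem suspFunctor_comp_tensorFunctor (P : GrBimod A B) (σ : Γ) :
    GrMod.suspFunctor B σ ⋙ P.tensorFunctor = P.tensorFunctor ⋙ GrMod.suspFunctor A σ :=
  Functor.hext (fun L => P.tensorObj_susp L σ) fun _ _ f => P.tensorFunctor_map_susp_heq σ f

theorem tensorModTorsion_additive (P : GrBimod A B) : P.tensorModTorsion.Additive where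
  map_add {L L' f g} := by
    apply ObjectProperty.hom_ext
    apply GrMod.hom_ext'
    refine DFunLike.ext _ _ fun x => ?_
    obtain ⟨x, rfl⟩ := QuotientAddGroup.mk_surjective x
    induction x using Tens.induct with
    | zero => exact (map_zero _).trans (map_zero _).symm
    | add x y hx hy =>
      exact (map_add _ _ _).trans ((congrArg₂ _ hx hy).trans (map_add _ _ _).symm)
    | tmul p l =>
      exact congrArg QuotientAddGroup.mk (Tens.tmul_add p (GrMod.fn f.hom l) (GrMod.fn g.hom l))

theorem suspension_comp_ι (B : IGrRing.{w, u} Γ) (σ : Γ) :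
    B.suspension σ ⋙ (GrMod.TorsionFree (A := B)).ι =
      (GrMod.TorsionFree (A := B)).ι ⋙ GrMod.suspFunctor B σ := rfl

theorem suspFunctor_comp_modTorsionFunctor (A : IGrRing.{w, u} Γ) (σ : Γ) :
    GrMod.suspFunctor A σ ⋙ A.modTorsionFunctor = A.modTorsionFunctor ⋙ A.suspension σ := rfl

theorem tensorModTorsion_isGradedFunctor (P : GrBimod A B) :
    IsGradedFunctor P.tensorModTorsion := by
  refine ⟨P.tensorModTorsion_additive, fun σ => ?_⟩
  rw [tensorModTorsion, ← Functor.assoc, suspension_comp_ι, Functor.assoc, ← Functor.assoc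
    (GrMod.suspFunctor B σ), suspFunctor_comp_tensorFunctor, Functor.assoc,
    suspFunctor_comp_modTorsionFunctor]
  rfl

end GrBimod

/-! ### Pairings of bimodules -/

namespace GrBimod

/-- The morphism `P ⊗_B L → N` induced by a balanced graded `A`-linear map `P × L → N`. -/
def tensorDesc (P : GrBimod A B) {L : GrMod B} {N : GrMod A}
    (f : P.carrier →+ L.carrier →+ N.carrier)
    (hbal : ∀ p (b : B.carrier) l, f (MulOpposite.op b • p) l = f p (b • l))
    (hsmul : ∀ (a : A.carrier) p l, f (a • p) l = a • f p l)
    (hmem : ∀ {σ τ p l}, p ∈ P.gr σ → l ∈ L.gr τ → f p l ∈ N.gr (σ * τ)) :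
    P.tensorObj L ⟶ N where
  toFun := Tens.lift f hbal
  map_smul a x := DFunLike.congr_fun
    (f := (Tens.lift f hbal).comp (Tens.map (act a) (AddMonoidHom.id L.carrier)
      (fun b p => smul_comm a (MulOpposite.op b) p) (fun _ _ => rfl)))
    (g := (act a).comp (Tens.lift f hbal)) (Tens.hom_ext (hsmul a)) x
  map_mem {σ x} hx := by
    induction hx using AddSubgroup.closure_induction with
    | mem x hx =>
      obtain ⟨ρ, τ, q, n, hq, hn, rfl, rfl⟩ := hx
      exact hmem hq hn
    | zero => exact (congrArg (· ∈ _) (map_zero (Tens.lift f hbal))).mpr (zero_mem _)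
    | add x y _ _ hx hy =>
      exact (congrArg (· ∈ _) (map_add (Tens.lift f hbal) x y)).mpr (add_mem hx hy)
    | neg x _ hx => exact (congrArg (· ∈ _) (map_neg (Tens.lift f hbal) x)).mpr (neg_mem hx)

/-- A graded bimodule pairing `P × Q → A`, balanced over `B`, whose values generate `A`: a
surjective graded homomorphism of bimodules `P ⊗_B Q → A`, given by its values on pure tensors.
In this form it is easily transported to the opposite rings. -/
structure Pairing (P : GrBimod A B) (Q : GrBimod B A) where
  toFun : P.carrier →+ Q.carrier →+ A.carrier
  map_smul : ∀ (a : A.carrier) (p : P.carrier) (q : Q.carrier),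
    toFun (a • p) q = a * toFun p q
  map_smul' : ∀ (a : A.carrier) (p : P.carrier) (q : Q.carrier),
    toFun p (MulOpposite.op a • q) = toFun p q * a
  balanced : ∀ (b : B.carrier) (p : P.carrier) (q : Q.carrier),
    toFun (MulOpposite.op b • p) q = toFun p (b • q)
  map_mem : ∀ {σ τ : Γ} {p : P.carrier} {q : Q.carrier},
    p ∈ P.gr σ → q ∈ Q.gr τ → toFun p q ∈ A.gr (σ * τ)
  span : AddSubgroup.closure {a | ∃ p q, a = toFun p q} = ⊤

/-- The pairing `(p, q) ↦ μ(p ⊗ q)`. -/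
def Hom.toPairing {P : GrBimod A B} {Q : GrBimod B A} (μ : Hom (P.tensor Q) (regular A))
    (hμ : Function.Surjective μ.toFun) : Pairing P Q where
  toFun := (AddMonoidHom.compHom μ.toFun).comp
    (Tens.mk : P.carrier →+ Q.carrier →+ Tens B.carrier P.carrier Q.carrier)
  map_smul a p q := μ.map_smul a (P.tmul Q p q)
  map_smul' a p q := μ.map_smul' a (P.tmul Q p q)
  balanced b p q := congrArg μ.toFun (Tens.smul_tmul p b q)
  map_mem hp hq := μ.map_mem (AddSubgroup.subset_closure ⟨_, _, _, _, hp, hq, rfl, rfl⟩)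
  span := by
    rw [eq_top_iff]
    rintro a -
    obtain ⟨x, rfl⟩ := hμ a
    induction x using Tens.induct with
    | zero => exact (congrArg (· ∈ _) (map_zero μ.toFun)).mpr (zero_mem _)
    | add x y hx hy => exact (congrArg (· ∈ _) (map_add μ.toFun x y)).mpr (add_mem hx hy)
    | tmul p q => exact AddSubgroup.subset_closure ⟨p, q, rfl⟩

namespace Pairing

variable {P : GrBimod A B} {Q : GrBimod B A}

/-- A pairing `Q × P → B`, as a pairing `P × Q → B` over the opposite rings. -/
def op (ψ : Pairing Q P) : Pairing P.op Q.op where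
  toFun := (AddMonoidHom.compHom (opAddEquiv (α := B.carrier)).toAddMonoidHom).comp ψ.toFun.flip
  map_smul b p q := congrArg MulOpposite.op (ψ.map_smul' b.unop q p)
  map_smul' b p q := congrArg MulOpposite.op (ψ.map_smul b.unop q p)
  balanced a p q := congrArg MulOpposite.op (ψ.balanced a.unop q p).symm
  map_mem hp hq := ψ.map_mem hq hp
  span := by
    rw [eq_top_iff]
    rintro ⟨b⟩ -
    have hb : b ∈ AddSubgroup.closure {a | ∃ q p, a = ψ.toFun q p} := by rw [ψ.span]; trivial
    induction hb using AddSubgroup.closure_induction with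
    | mem b hb =>
      obtain ⟨q, p, rfl⟩ := hb
      exact AddSubgroup.subset_closure ⟨p, q, rfl⟩
    | zero => exact zero_mem _
    | add a b _ _ ha hb => exact add_mem ha hb
    | neg a _ ha => exact neg_mem ha

variable (φ : Pairing P Q)

/-- The biadditive map sending `(q, n)` to the homomorphism `p ↦ (p, q) n`. -/
def hom (N : GrMod A) : Q.carrier →+ N.carrier →+ P.carrier →+ N.carrier :=
  AddMonoidHom.mk' (fun q => AddMonoidHom.mk' (fun n => (act.flip n).comp (φ.toFun.flip q))
      (fun n n' => AddMonoidHom.ext fun p => smul_add (φ.toFun p q) n n'))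
    (fun q q' => AddMonoidHom.ext fun n => AddMonoidHom.ext fun p => by
      change φ.toFun p (q + q') • n = φ.toFun p q • n + φ.toFun p q' • n
      rw [map_add, NUModule.add_smul'])

theorem hom_apply (N : GrMod A) (q : Q.carrier) (n : N.carrier) (p : P.carrier) :
    φ.hom N q n p = φ.toFun p q • n := rfl

theorem hom_mem_homDeg (N : GrMod A) {σ τ : Γ} {q : Q.carrier} {n : N.carrier}
    (hq : q ∈ Q.gr σ) (hn : n ∈ N.gr τ) : φ.hom N q n ∈ GrMod.homDeg P.left N (σ * τ) := by
  refine ⟨fun a p => ?_, fun ρ p hp => ?_⟩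
  · rw [hom_apply, hom_apply, φ.map_smul, NUModule.mul_smul']
  · rw [← mul_assoc]
    exact N.smul_mem (φ.map_mem hp hq) hn

theorem hom_mem_HOM (N : GrMod A) (q : Q.carrier) (n : N.carrier) :
    φ.hom N q n ∈ GrMod.HOM P.left N := by
  refine Q.internal.induct (p := fun q => φ.hom N q n ∈ GrMod.HOM P.left N) q ?_ ?_ ?_
  · rw [map_zero]; exact zero_mem _
  · intro a b ha hb
    rw [map_add]; exact add_mem ha hb
  · intro σ q hq
    refine N.internal.induct (p := fun n => φ.hom N q n ∈ GrMod.HOM P.left N) n ?_ ?_ ?_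
    · rw [map_zero]; exact zero_mem _
    · intro a b ha hb
      rw [map_add]; exact add_mem ha hb
    · intro τ n hn
      exact AddSubgroup.mem_iSup_of_mem (σ * τ) (φ.hom_mem_homDeg N hq hn)

/-- The map `p ↦ (p, b q) n` is `b` times the map `p ↦ (p, q) n`. -/
theorem hom_smul (N : GrMod A) (b : B.carrier) (q : Q.carrier) (n : N.carrier) :
    φ.hom N (b • q) n = (φ.hom N q n).comp (P.rmul b) :=
  AddMonoidHom.ext fun p => by
    change φ.toFun p (b • q) • n = φ.toFun (MulOpposite.op b • p) q • n
    rw [φ.balanced]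

theorem hom_mem_smulHOM (N : GrMod A) (q : Q.carrier) (n : N.carrier) :
    φ.hom N q n ∈ P.smulHOM N := by
  have hq : q ∈ smulSpan B.carrier Q.carrier := by rw [Q.unital]; trivial
  induction hq using AddSubgroup.closure_induction with
  | mem q hq =>
    obtain ⟨b, q, rfl⟩ := hq
    exact AddSubgroup.subset_closure ⟨b, _, φ.hom_mem_HOM N q n, φ.hom_smul N b q n⟩
  | zero => rw [map_zero]; exact zero_mem _
  | add a b _ _ ha hb => rw [map_add]; exact add_mem ha hb
  | neg a _ ha => rw [map_neg]; exact neg_mem ha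

/-- The map `(q, n) ↦ (p ↦ (p, q) n)` with values in `B · HOM_A(P, N)`. -/
def smulHom (N : GrMod A) : Q.carrier →+ N.carrier →+ P.smulHOM N :=
  AddMonoidHom.mk' (fun q => (φ.hom N q).codRestrict (P.smulHOM N) (φ.hom_mem_smulHOM N q))
    (fun q q' => AddMonoidHom.ext fun n => Subtype.ext <| by
      change φ.hom N (q + q') n = φ.hom N q n + φ.hom N q' n
      rw [map_add, AddMonoidHom.add_apply])

/-- The canonical morphism `Q ⊗_A N → B · HOM_A(P, N)`, `q ⊗ n ↦ (p ↦ (p, q) n)`. -/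
def tensorToHOM (N : GrMod A) : Q.tensorObj N ⟶ P.smulHOMObj N :=
  Q.tensorDesc (N := P.smulHOMObj N) (φ.smulHom N)
    (fun q a n => Subtype.ext (AddMonoidHom.ext fun p => by
      change φ.toFun p (MulOpposite.op a • q) • n = φ.toFun p q • a • n
      rw [φ.map_smul', NUModule.mul_smul']))
    (fun b q n => Subtype.ext (φ.hom_smul N b q n))
    (fun hq hn => φ.hom_mem_homDeg N hq hn)

/-- A homogeneous `q` and a homogeneous `m` give a morphism `P(σ) → M`, `p ↦ (p, q) m`, where
`σ⁻¹ = deg q * deg m`; the images of these morphisms generate `M`. -/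
theorem generates (φ : Pairing P Q) (M : GrMod A) : P.left.Generates M := by
  intro N f hf
  by_contra hcon
  push Not at hcon
  refine hf (GrMod.hom_ext' (AddMonoidHom.ext fun m => ?_))
  refine NUModule.smulSpan_induction φ.span M.unital (GrMod.fn f).ker ?_ m
  rintro _ ⟨p, q, rfl⟩ m
  change GrMod.fn f (φ.hom M q m p) = 0
  refine Q.internal.induct (p := fun q => GrMod.fn f (φ.hom M q m p) = 0) q (by simp)
    (fun a b ha hb => by simp [ha, hb]) fun σ q hq => ?_
  refine M.internal.induct (p := fun m => GrMod.fn f (φ.hom M q m p) = 0) m (by simp)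
    (fun a b ha hb => by simp [ha, hb]) fun τ m hm => ?_
  have h := φ.hom_mem_homDeg M hq hm
  let g : P.left.susp (σ * τ)⁻¹ ⟶ M :=
    { toFun := φ.hom M q m
      map_smul := h.1
      map_mem := fun {ρ p} hp => by
        have := h.2 _ p hp
        rwa [inv_mul_cancel_right] at this }
  exact DFunLike.congr_fun (congrArg GrMod.fn (hcon _ g)) p

theorem flip_mem_smulHOM (q : Q.carrier) :
    φ.toFun.flip q ∈ P.smulHOM A.regularModule := by
  have hq : q ∈ smulSpan A.carrierᵐᵒᵖ Q.carrier := by rw [Q.unital']; trivial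
  induction hq using AddSubgroup.closure_induction with
  | mem q hq =>
    obtain ⟨a, q, rfl⟩ := hq
    exact (congrArg (· ∈ P.smulHOM A.regularModule)
      (AddMonoidHom.ext fun p => φ.map_smul' a.unop p q)).mpr
        (φ.hom_mem_smulHOM A.regularModule q a.unop)
  | zero => rw [map_zero]; exact zero_mem _
  | add a b _ _ ha hb => rw [map_add]; exact add_mem ha hb
  | neg a _ ha => rw [map_neg]; exact neg_mem ha

/-- The canonical morphism `Q → B · HOM_A(P, A)`, `q ↦ (-, q)`. -/
def toDual : Q.left ⟶ P.smulHOMObj A.regularModule where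
  toFun := φ.toFun.flip.codRestrict (P.smulHOM A.regularModule) φ.flip_mem_smulHOM
  map_smul b q := Subtype.ext (AddMonoidHom.ext fun p => (φ.balanced b p q).symm)
  map_mem hq := ⟨fun a p => φ.map_smul a p _, fun _ _ hp => φ.map_mem hp hq⟩

end Pairing
end GrBimod

/-! ### Surjective Morita contexts -/

theorem GrMod.HOM_smul {M N : GrMod A} {f : M.carrier →+ N.carrier} (hf : f ∈ GrMod.HOM M N)
    (a : A.carrier) (m : M.carrier) : f (a • m) = a • f m := by
  induction hf using GrMod.HOM_induct with
  | mem σ f hf => exact hf.1 a m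
  | zero => simp
  | add f g _ _ hf hg => simp only [AddMonoidHom.add_apply, hf, hg, smul_add]

namespace GrBimod

/-- A graded Morita context with surjective pairings `φ = (-, -)` and `ψ = [-, -]`. It is
symmetric under `(P, Q) ↦ (Q, P)` and under passage to the opposite rings. -/
structure MoritaPairing (P : GrBimod A B) (Q : GrBimod B A) where
  φ : Pairing P Q
  ψ : Pairing Q P
  assoc : ∀ (p p' : P.carrier) (q : Q.carrier),
    MulOpposite.op (ψ.toFun q p) • p' = φ.toFun p' q • p
  assoc' : ∀ (q q' : Q.carrier) (p : P.carrier),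
    MulOpposite.op (φ.toFun p q) • q' = ψ.toFun q' p • q

theorem rmul_mem_homDeg (P : GrBimod A B) {σ : Γ} {b : B.carrier} (hb : b ∈ B.gr σ) :
    P.rmul b ∈ GrMod.homDeg P.left P.left σ :=
  ⟨fun a p => (smul_comm a (MulOpposite.op b) p).symm, fun _ _ hp => P.smul_mem' hp hb⟩

/-- The additive map `b ↦ (p ↦ p b)`. -/
def rmulHom (P : GrBimod A B) : B.carrier →+ P.carrier →+ P.carrier :=
  (act : B.carrierᵐᵒᵖ →+ P.carrier →+ P.carrier).comp opAddEquiv.toAddMonoidHom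

/-- The evaluation morphism `P ⊗_B (B · HOM_A(P, N)) → N`, `p ⊗ f ↦ f(p)`. -/
def evalTensor (P : GrBimod A B) (N : GrMod A) : P.tensorObj (P.smulHOMObj N) ⟶ N :=
  P.tensorDesc (L := P.smulHOMObj N) (P.smulHOM N).subtype.flip (fun _ _ _ => rfl)
    (fun a p f => GrMod.HOM_smul (P.smulHOM_le N f.2) a p)
    (fun hp hf => hf.2 _ _ hp)

namespace MoritaPairing

variable {P : GrBimod A B} {Q : GrBimod B A}

/-- The Morita context `(B, A, Q, P)`. -/
def swap (C : MoritaPairing P Q) : MoritaPairing Q P := ⟨C.ψ, C.φ, C.assoc', C.assoc⟩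

/-- The Morita context of right modules: `(Bᵒᵖ, Aᵒᵖ, P, Q)`. -/
def op (C : MoritaPairing P Q) : MoritaPairing P.op Q.op where
  φ := C.ψ.op
  ψ := C.φ.op
  assoc p p' q := (C.assoc p' p q).symm
  assoc' q q' p := (C.assoc' q' q p).symm

variable (C : MoritaPairing P Q)

/-- The identity `f(p' [q, p]) = f((p', q) p) = (p', q) f(p)`. -/
theorem comp_rmul_eq_hom {N : GrMod A} {f : P.carrier →+ N.carrier}
    (hf : f ∈ GrMod.HOM P.left N) (q : Q.carrier) (p : P.carrier) :
    f.comp (P.rmul (C.ψ.toFun q p)) = C.φ.hom N q (f p) :=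
  AddMonoidHom.ext fun p' => by
    change f (MulOpposite.op (C.ψ.toFun q p) • p') = C.φ.toFun p' q • f p
    rw [C.assoc]
    exact GrMod.HOM_smul hf _ _

/-- Since `B` is additively generated by the `[q, p]`, the group `B · HOM_A(P, N)` is
generated by the maps `p ↦ (p, q) n`. -/
theorem smulHOM_le_of_hom_mem (N : GrMod A) {H : AddSubgroup (P.carrier →+ N.carrier)}
    (h : ∀ q n, C.φ.hom N q n ∈ H) : P.smulHOM N ≤ H := by
  rw [smulHOM, AddSubgroup.closure_le]
  rintro _ ⟨b, f, hf, rfl⟩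
  have hb : b ∈ AddSubgroup.closure {b | ∃ q p, b = C.ψ.toFun q p} := by rw [C.ψ.span]; trivial
  have hle : AddSubgroup.closure {b | ∃ q p, b = C.ψ.toFun q p} ≤
      H.comap ((AddMonoidHom.compHom f).comp P.rmulHom) := by
    rw [AddSubgroup.closure_le]
    rintro _ ⟨q, p, rfl⟩
    change f.comp (P.rmul (C.ψ.toFun q p)) ∈ H
    rw [C.comp_rmul_eq_hom hf]
    exact h q (f p)
  exact hle hb

theorem tensorToHOM_surjective (N : GrMod A) :
    Function.Surjective (GrMod.fn (C.φ.tensorToHOM N)) := by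
  rintro ⟨f, hf⟩
  have hle := C.smulHOM_le_of_hom_mem N
    (H := ((P.smulHOM N).subtype.comp (show (Q.tensorObj N).carrier →+ P.smulHOM N from
      GrMod.fn (C.φ.tensorToHOM N))).range)
    (fun q n => ⟨Tens.tmul A.carrier q n, rfl⟩) hf
  obtain ⟨x, hx⟩ := hle
  exact ⟨x, Subtype.ext hx⟩

/-- The identity `[q, p] x = q ⊗ Φ(x)(p)` for `x ∈ Q ⊗_A N`, where `Φ` is the canonical map to
`B · HOM_A(P, N)`. It shows that the kernel of `Φ` is torsion. -/
theorem smul_tensor_eq (N : GrMod A) (q : Q.carrier) (p : P.carrier)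
    (x : (Q.tensorObj N).carrier) :
    C.ψ.toFun q p • x = (Tens.tmul A.carrier q
      ((show P.smulHOM N from GrMod.fn (C.φ.tensorToHOM N) x).1 p) : (Q.tensorObj N).carrier) := by
  refine DFunLike.congr_fun (f := (act (C.ψ.toFun q p) :
      (Q.tensorObj N).carrier →+ (Q.tensorObj N).carrier))
    (g := (Tens.mk q : N.carrier →+ Tens A.carrier Q.carrier N.carrier).comp
      ((AddMonoidHom.eval p).comp ((P.smulHOM N).subtype.comp
        (show (Q.tensorObj N).carrier →+ P.smulHOM N from GrMod.fn (C.φ.tensorToHOM N)))))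
    (Tens.hom_ext fun q' n => ?_) x
  change Tens.tmul A.carrier (C.ψ.toFun q p • q') n =
    Tens.tmul A.carrier q (C.φ.toFun p q' • n)
  rw [← C.assoc', Tens.smul_tmul]

theorem mem_torsion_of_tensorToHOM_eq_zero (N : GrMod A) (x : (Q.tensorObj N).carrier)
    (hx : GrMod.fn (C.φ.tensorToHOM N) x = 0) :
    x ∈ torsion B.carrier (Q.tensorObj N).carrier := by
  refine NUModule.mem_torsion_of_closure_eq_top C.ψ.span ?_
  rintro _ ⟨q, p, rfl⟩
  rw [C.smul_tensor_eq, hx]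
  exact map_zero (Tens.mk q)

/-- The natural isomorphism `Q ⊗_A N / t_B(Q ⊗_A N) ≅ B · HOM_A(P, N)`. -/
noncomputable def tensorIsoHOM : Q.tensorModTorsion ≅ P.smulHOMFunctor :=
  NatIso.ofComponents
    (fun N => GrMod.modTorsionIso (N := P.smulHOMFunctor.obj N) (C.φ.tensorToHOM N.obj)
      (C.tensorToHOM_surjective N.obj) (C.mem_torsion_of_tensorToHOM_eq_zero N.obj))
    (fun {N N'} f => by
      apply ObjectProperty.hom_ext
      apply GrMod.hom_ext'
      apply QuotientAddGroup.addMonoidHom_ext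
      refine Tens.hom_ext fun q n => Subtype.ext (AddMonoidHom.ext fun p => ?_)
      exact (GrMod.fn_smul f.hom (C.φ.toFun p q) n).symm)

theorem tensorIsoHOM_apply (N : A.Gr) (q : Q.carrier) (n : N.obj.carrier) (p : P.carrier) :
    P.evalHOM N (GrMod.fn (C.tensorIsoHOM.hom.app N).hom (Q.tmulMod N q n)) p =
      C.φ.toFun p q • n := rfl

/-! ### The equivalence of categories -/

theorem evalTensor_surjective (C : MoritaPairing P Q) (N : GrMod A) :
    Function.Surjective (GrMod.fn (P.evalTensor N)) := by
  intro n
  refine NUModule.smulSpan_induction C.φ.span N.unital (GrMod.fn (P.evalTensor N)).range ?_ n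
  rintro _ ⟨p, q, rfl⟩ n
  exact ⟨Tens.tmul B.carrier p (C.φ.smulHom N q n), rfl⟩

/-- The identity `(p, q) x = p ⊗ (p' ↦ (p', q) ev(x))`, which for `x = p₁ ⊗ f` reads
`(p, q) p₁ ⊗ f = p [q, p₁] ⊗ f = p ⊗ [q, p₁] f`. It shows that the kernel of the evaluation
morphism is torsion. -/
theorem smul_evalTensor_eq (N : GrMod A) (p : P.carrier) (q : Q.carrier)
    (x : (P.tensorObj (P.smulHOMObj N)).carrier) :
    C.φ.toFun p q • x = (Tens.tmul B.carrier p
      (show (P.smulHOMObj N).carrier from C.φ.smulHom N q (GrMod.fn (P.evalTensor N) x)) :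
        (P.tensorObj (P.smulHOMObj N)).carrier) := by
  refine DFunLike.congr_fun (f := (act (C.φ.toFun p q) :
      (P.tensorObj (P.smulHOMObj N)).carrier →+ (P.tensorObj (P.smulHOMObj N)).carrier))
    (g := (Tens.mk p : (P.smulHOMObj N).carrier →+
        Tens B.carrier P.carrier (P.smulHOMObj N).carrier).comp
      ((show N.carrier →+ (P.smulHOMObj N).carrier from C.φ.smulHom N q).comp
        (GrMod.fn (P.evalTensor N))))
    (Tens.hom_ext fun p' f => ?_) x
  have hf : C.ψ.toFun q p' • f =
      (show (P.smulHOMObj N).carrier from C.φ.smulHom N q (f.1 p')) :=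
    Subtype.ext (C.comp_rmul_eq_hom (P.smulHOM_le N f.2) q p')
  change Tens.tmul B.carrier (C.φ.toFun p q • p') f = Tens.tmul B.carrier p
    (show (P.smulHOMObj N).carrier from C.φ.smulHom N q (f.1 p'))
  rw [← C.assoc, Tens.smul_tmul, hf]

theorem mem_torsion_of_evalTensor_eq_zero (C : MoritaPairing P Q) (N : GrMod A)
    (x : (P.tensorObj (P.smulHOMObj N)).carrier) (hx : GrMod.fn (P.evalTensor N) x = 0) :
    x ∈ torsion A.carrier (P.tensorObj (P.smulHOMObj N)).carrier := by
  refine NUModule.mem_torsion_of_closure_eq_top C.φ.span ?_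
  rintro _ ⟨p, q, rfl⟩
  rw [C.smul_evalTensor_eq, hx]
  refine (congrArg (Tens.mk (R := B.carrier) (N := (P.smulHOMObj N).carrier) p)
    (map_zero (C.φ.smulHom N q))).trans (map_zero (Tens.mk p))

/-- The natural isomorphism `P ⊗_B (B · HOM_A(P, N)) / t_A(P ⊗_B (B · HOM_A(P, N))) ≅ N`. -/
noncomputable def homTensorIso : P.smulHOMFunctor ⋙ P.tensorModTorsion ≅ 𝟭 A.Gr :=
  NatIso.ofComponents
    (fun N => GrMod.modTorsionIso (N := N) (P.evalTensor N.obj)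
      (C.evalTensor_surjective N.obj) (C.mem_torsion_of_evalTensor_eq_zero N.obj))
    (fun {N N'} f => by
      apply ObjectProperty.hom_ext
      apply GrMod.hom_ext'
      apply QuotientAddGroup.addMonoidHom_ext
      exact Tens.hom_ext fun p g => rfl)

/-- The functors `Q ⊗_A -` and `P ⊗_B -`, modulo torsion, compose to the identity of `A-gr`. -/
noncomputable def tensorTensorIso : Q.tensorModTorsion ⋙ P.tensorModTorsion ≅ 𝟭 A.Gr :=
  Functor.isoWhiskerRight C.tensorIsoHOM P.tensorModTorsion ≪≫ C.homTensorIso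

theorem areInverseGradedEquivalences (C : MoritaPairing P Q) :
    AreInverseGradedEquivalences P.tensorModTorsion Q.tensorModTorsion :=
  ⟨P.tensorModTorsion_isGradedFunctor, Q.tensorModTorsion_isGradedFunctor,
    ⟨C.swap.tensorTensorIso⟩, ⟨C.tensorTensorIso⟩⟩

/-! ### The bimodules of the context as homomorphism modules -/

theorem toDual_bijective (hQ : GrMod.TorsionFree Q.left) :
    Function.Bijective (GrMod.fn C.φ.toDual) := by
  constructor
  · refine (injective_iff_map_eq_zero _).2 fun q hq => hQ q ?_
    refine NUModule.mem_torsion_of_closure_eq_top C.ψ.span ?_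
    rintro _ ⟨q', p, rfl⟩
    have h : C.φ.toFun p q = 0 := DFunLike.congr_fun (congrArg Subtype.val hq) p
    rw [← C.assoc', h, MulOpposite.op_zero, NUModule.zero_smul']
  · rintro ⟨f, hf⟩
    have hle := C.smulHOM_le_of_hom_mem A.regularModule (H := C.φ.toFun.flip.range)
      (fun q (a : A.carrier) => ⟨MulOpposite.op a • q,
        AddMonoidHom.ext fun p => C.φ.map_smul' a p q⟩) hf
    obtain ⟨q, hq⟩ := hle
    exact ⟨q, Subtype.ext hq⟩

/-- The isomorphism `Q ≅ B · HOM_A(P, A)` of left `B`-modules. -/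
noncomputable def dualIso (hQ : GrMod.TorsionFree Q.left) (hA : A.TorsionFree) :
    (⟨Q.left, hQ⟩ : B.Gr) ≅ P.smulHOMFunctor.obj (IGrRing.regularGr hA) :=
  GrMod.isoOfBijective (M := ⟨Q.left, hQ⟩)
    (N := P.smulHOMFunctor.obj (IGrRing.regularGr hA)) C.φ.toDual (C.toDual_bijective hQ)

theorem dualIso_apply (hQ : GrMod.TorsionFree Q.left) (hA : A.TorsionFree) (q : Q.carrier)
    (p : P.carrier) :
    P.evalHOM (IGrRing.regularGr hA) (GrMod.fn (C.dualIso hQ hA).hom.hom q) p =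
      C.φ.toFun p q := rfl

/-- The isomorphism `Q ⊗_A A / t_B(Q ⊗_A A) ≅ Q` of left `B`-modules. -/
noncomputable def tensorRegularIso (hQ : GrMod.TorsionFree Q.left) (hA : A.TorsionFree) :
    Q.tensorModTorsion.obj (IGrRing.regularGr hA) ≅ (⟨Q.left, hQ⟩ : B.Gr) :=
  C.tensorIsoHOM.app (IGrRing.regularGr hA) ≪≫ (C.dualIso hQ hA).symm

/-- The formula is checked after applying the injection `q ↦ (-, q)`, which turns it into
`(p, q) a = (p, q a)`. -/
theorem tensorRegularIso_apply (hQ : GrMod.TorsionFree Q.left) (hA : A.TorsionFree)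
    (q : Q.carrier) (a : A.carrier) :
    GrMod.fn (C.tensorRegularIso hQ hA).hom.hom (Q.tmulMod (IGrRing.regularGr hA) q a) =
      MulOpposite.op a • q := by
  apply (C.toDual_bijective hQ).1
  have h : (C.tensorRegularIso hQ hA).hom ≫ (C.dualIso hQ hA).hom =
      C.tensorIsoHOM.hom.app (IGrRing.regularGr hA) := by
    simp [tensorRegularIso]
  refine (DFunLike.congr_fun (congrArg (fun g => GrMod.fn g.hom) h)
    (Q.tmulMod (IGrRing.regularGr hA) q a)).trans ?_
  exact Subtype.ext (AddMonoidHom.ext fun p => (C.φ.map_smul' a p q).symm)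

/-! ### The rings of the context as endomorphism rings -/

theorem rmul_mem_smulHOM (C : MoritaPairing P Q) (b : B.carrier) : P.rmul b ∈ P.smulHOM P.left := by
  have hb : b ∈ AddSubgroup.closure {b | ∃ q p, b = C.ψ.toFun q p} := by rw [C.ψ.span]; trivial
  have hle : AddSubgroup.closure {b | ∃ q p, b = C.ψ.toFun q p} ≤
      (P.smulHOM P.left).comap P.rmulHom := by
    rw [AddSubgroup.closure_le]
    rintro _ ⟨q, p, rfl⟩
    exact (congrArg (· ∈ P.smulHOM P.left) (AddMonoidHom.ext fun p' => C.assoc p p' q)).mpr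
      (C.φ.hom_mem_smulHOM P.left q p)
  exact hle hb

/-- The canonical morphism `B → B · END_A(P)`, `b ↦ (p ↦ p b)`, of graded left `B`-modules. -/
def toEND : B.regularModule ⟶ P.smulHOMObj P.left where
  toFun := P.rmulHom.codRestrict (P.smulHOM P.left) C.rmul_mem_smulHOM
  map_smul c b := Subtype.ext (AddMonoidHom.ext fun p =>
    NUModule.mul_smul' (R := B.carrierᵐᵒᵖ) (MulOpposite.op b) (MulOpposite.op c) p)
  map_mem hb := P.rmul_mem_homDeg hb

theorem toEND_bijective (C : MoritaPairing P Q) (hB : B.TorsionFree) :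
    Function.Bijective (GrMod.fn C.toEND) := by
  constructor
  · refine (injective_iff_map_eq_zero _).2 fun b hb => hB.1 b ?_
    refine NUModule.mem_torsion_of_closure_eq_top (M := B.regularModule.carrier) C.ψ.span ?_
    rintro _ ⟨q, p, rfl⟩
    have h : MulOpposite.op (show B.carrier from b) • p = 0 :=
      DFunLike.congr_fun (congrArg Subtype.val hb) p
    change C.ψ.toFun q p * (show B.carrier from b) = 0
    rw [← C.ψ.map_smul', h, map_zero]
  · rintro ⟨f, hf⟩
    have hle := C.smulHOM_le_of_hom_mem P.left (H := P.rmulHom.range)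
      (fun q p => ⟨C.ψ.toFun q p, AddMonoidHom.ext fun p' => C.assoc p p' q⟩) hf
    obtain ⟨b, hb⟩ := hle
    exact ⟨b, Subtype.ext hb⟩

theorem rightCanonicalIso (C : MoritaPairing P Q) (hB : B.TorsionFree) : P.RightCanonicalIso := by
  let f : B.carrier →ₙ+* (P.smulEND)ᵐᵒᵖ :=
    { toFun := fun b => MulOpposite.op ⟨P.rmulHom b, C.rmul_mem_smulHOM b⟩
      map_mul' := fun b c => unop_injective (Subtype.ext (AddMonoidHom.ext fun p =>
        NUModule.mul_smul' (MulOpposite.op c) (MulOpposite.op b) p))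
      map_zero' := unop_injective (Subtype.ext (map_zero P.rmulHom))
      map_add' := fun b c => unop_injective (Subtype.ext (map_add P.rmulHom b c)) }
  have hf : Function.Bijective f := by
    constructor
    · intro b c h
      exact (C.toEND_bijective hB).1 (Subtype.ext (congrArg (fun x => x.unop.1) h))
    · rintro ⟨g, hg⟩
      obtain ⟨b, hb⟩ := (C.toEND_bijective hB).2 ⟨g, hg⟩
      exact ⟨b, unop_injective (Subtype.ext (congrArg Subtype.val hb))⟩
  exact ⟨RingEquiv.ofBijective f hf, fun _ _ => rfl,
    fun σ b => GrMod.hom_mem_iff C.toEND (C.toEND_bijective hB).1⟩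

end MoritaPairing

/-- Endomorphisms of `P_B` are written on the left, those of the left `Bᵒᵖ`-module `P` on the right,
so passing to the opposite rings turns one canonical isomorphism into the other. -/
theorem RightCanonicalIso.leftCanonicalIso {P : GrBimod A B} (h : P.op.RightCanonicalIso) :
    P.LeftCanonicalIso := by
  obtain ⟨e, he, hdeg⟩ := h
  exact ⟨RingEquiv.op.symm e, fun a p => he (MulOpposite.op a) p,
    fun σ a => hdeg (MulOpposite.op σ) (MulOpposite.op a)⟩

/-! ### The tensor products as graded rings -/

/-- The multiplication `x y = μ(x) y` on `P ⊗_B Q`. -/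
def Hom.mul {P : GrBimod A B} {Q : GrBimod B A} (μ : Hom (P.tensor Q) (regular A)) :
    (P.tensor Q).carrier →+ (P.tensor Q).carrier →+ (P.tensor Q).carrier :=
  (act : A.carrier →+ (P.tensor Q).carrier →+ (P.tensor Q).carrier).comp μ.toFun

theorem Hom.mul_isGradedRingMul {P : GrBimod A B} {Q : GrBimod B A}
    (μ : Hom (P.tensor Q) (regular A)) : IsGradedRingMul (P.tensor Q).gr μ.mul where
  internal := (P.tensor Q).internal
  assoc x y z := by
    let a : A.carrier := μ.toFun x
    change (show A.carrier from μ.toFun (a • y)) • z = a • (show A.carrier from μ.toFun y) • z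
    rw [μ.map_smul]
    exact NUModule.mul_smul' a _ z
  mul_mem hx hy := (P.tensor Q).smul_mem (μ.map_mem hx) hy

end GrBimod

/-- The Morita context given by `μ` and `ν`, in terms of pairings. -/
def GrMoritaContext.toMoritaPairing {P : GrBimod A B} {Q : GrBimod B A} (C : GrMoritaContext P Q)
    (hμ : Function.Surjective C.μ.toFun) (hν : Function.Surjective C.ν.toFun) :
    GrBimod.MoritaPairing P Q :=
  ⟨C.μ.toPairing hμ, C.ν.toPairing hν, C.assoc, C.assoc'⟩

/-- `(p₁ ⊗ q₁) (p₂ ⊗ q₂) = (p₁, q₁) p₂ ⊗ q₂ = p₁ [q₁, p₂] ⊗ q₂ = p₁ ⊗ [q₁, p₂] q₂`. -/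
theorem GrMoritaContext.mul_tmul_tmul {P : GrBimod A B} {Q : GrBimod B A}
    (C : GrMoritaContext P Q) (p₁ p₂ : P.carrier) (q₁ q₂ : Q.carrier) :
    C.μ.mul (P.tmul Q p₁ q₁) (P.tmul Q p₂ q₂) = P.tmul Q p₁ (C.ν.pairing q₁ p₂ • q₂) := by
  change Tens.tmul B.carrier (C.μ.pairing p₁ q₁ • p₂) q₂ = Tens.tmul B.carrier p₁ _
  rw [← C.assoc, Tens.smul_tmul]

/-- `(q₁ ⊗ p₁) (q₂ ⊗ p₂) = [q₁, p₁] q₂ ⊗ p₂ = q₁ (p₁, q₂) ⊗ p₂`. -/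
theorem GrMoritaContext.mul_tmul_tmul' {P : GrBimod A B} {Q : GrBimod B A}
    (C : GrMoritaContext P Q) (q₁ q₂ : Q.carrier) (p₁ p₂ : P.carrier) :
    C.ν.mul (Q.tmul P q₁ p₁) (Q.tmul P q₂ p₂) =
      Q.tmul P (MulOpposite.op (C.μ.pairing p₁ q₂) • q₁) p₂ := by
  change Tens.tmul A.carrier (C.ν.pairing q₁ p₁ • q₂) p₂ = Tens.tmul A.carrier _ p₂
  rw [← C.assoc']

end Graded

theorem mainTheorem2 {Γ : Type w} [Group Γ] [DecidableEq Γ] (A B : IGrRing.{w, u} Γ)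
    (hA : A.TorsionFree) (hB : B.TorsionFree)
    (P : GrBimod A B) (Q : GrBimod B A) (hP : P.TorsionFree) (hQ : Q.TorsionFree)
    (C : GrMoritaContext P Q)
    (hμ : Function.Surjective C.μ.toFun) (hν : Function.Surjective C.ν.toFun) :
    -- (1) generators
    (IsGradedGenerator (P.leftGr hP) ∧ IsGradedGenerator (P.rightGr hP) ∧
      IsGradedGenerator (Q.leftGr hQ) ∧ IsGradedGenerator (Q.rightGr hQ)) ∧
    -- (2) the rings as subrings of endomorphism rings
    (Q.RightCanonicalIso ∧ P.LeftCanonicalIso ∧ Q.LeftCanonicalIso ∧ P.RightCanonicalIso) ∧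
    -- (3) the inverse graded equivalences
    AreInverseGradedEquivalences P.tensorModTorsion Q.tensorModTorsion ∧
    -- (4) the natural isomorphisms
    ((∃ α : P.tensorModTorsion ≅ Q.smulHOMFunctor,
        ∀ (L : B.Gr) (p : P.carrier) (l : L.obj.carrier) (q : Q.carrier),
          Q.evalHOM L (GrMod.fn (α.hom.app L).hom (P.tmulMod L p l)) q = C.ν.pairing q p • l) ∧
      (∃ α : Q.tensorModTorsion ≅ P.smulHOMFunctor,
        ∀ (K : A.Gr) (q : Q.carrier) (k : K.obj.carrier) (p : P.carrier),
          P.evalHOM K (GrMod.fn (α.hom.app K).hom (Q.tmulMod K q k)) p = C.μ.pairing p q • k)) ∧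
    -- (5) the four modules `_B Q`, `Q_A`, `_A P`, `P_B`
    (((∃ e : Q.leftGr hQ ≅ P.smulHOMFunctor.obj (IGrRing.regularGr hA),
          ∀ (q : Q.carrier) (p : P.carrier),
            P.evalHOM (IGrRing.regularGr hA) (GrMod.fn e.hom.hom q) p = C.μ.pairing p q) ∧
        (∃ e : Q.tensorModTorsion.obj (IGrRing.regularGr hA) ≅ Q.leftGr hQ,
          ∀ (q : Q.carrier) (a : A.carrier),
            GrMod.fn e.hom.hom (Q.tmulMod (IGrRing.regularGr hA) q a) = op a • q)) ∧
      ((∃ e : Q.rightGr hQ ≅ P.op.smulHOMFunctor.obj (IGrRing.regularGr hB.op),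
          ∀ (q : Q.carrier) (p : P.carrier),
            P.op.evalHOM (IGrRing.regularGr hB.op) (GrMod.fn e.hom.hom q) p =
              op (C.ν.pairing q p)) ∧
        (∃ e : Q.op.tensorModTorsion.obj (IGrRing.regularGr hB.op) ≅ Q.rightGr hQ,
          ∀ (q : Q.carrier) (b : B.carrier),
            GrMod.fn e.hom.hom (Q.op.tmulMod (IGrRing.regularGr hB.op) q (op b)) = b • q)) ∧
      ((∃ e : P.leftGr hP ≅ Q.smulHOMFunctor.obj (IGrRing.regularGr hB),
          ∀ (p : P.carrier) (q : Q.carrier),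
            Q.evalHOM (IGrRing.regularGr hB) (GrMod.fn e.hom.hom p) q = C.ν.pairing q p) ∧
        (∃ e : P.tensorModTorsion.obj (IGrRing.regularGr hB) ≅ P.leftGr hP,
          ∀ (p : P.carrier) (b : B.carrier),
            GrMod.fn e.hom.hom (P.tmulMod (IGrRing.regularGr hB) p b) = op b • p)) ∧
      ((∃ e : P.rightGr hP ≅ Q.op.smulHOMFunctor.obj (IGrRing.regularGr hA.op),
          ∀ (p : P.carrier) (q : Q.carrier),
            Q.op.evalHOM (IGrRing.regularGr hA.op) (GrMod.fn e.hom.hom p) q =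
              op (C.μ.pairing p q)) ∧
        (∃ e : P.op.tensorModTorsion.obj (IGrRing.regularGr hA.op) ≅ P.rightGr hP,
          ∀ (p : P.carrier) (a : A.carrier),
            GrMod.fn e.hom.hom (P.op.tmulMod (IGrRing.regularGr hA.op) p (op a)) = a • p))) ∧
    -- (6) the graded rings `P ⊗_B Q` and `Q ⊗_A P`
    ((∃ m : (P.tensor Q).carrier →+ (P.tensor Q).carrier →+ (P.tensor Q).carrier,
        IsGradedRingMul (P.tensor Q).gr m ∧
        ∀ (p₁ p₂ : P.carrier) (q₁ q₂ : Q.carrier),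
          m (P.tmul Q p₁ q₁) (P.tmul Q p₂ q₂) = P.tmul Q p₁ (C.ν.pairing q₁ p₂ • q₂)) ∧
      (∃ m : (Q.tensor P).carrier →+ (Q.tensor P).carrier →+ (Q.tensor P).carrier,
        IsGradedRingMul (Q.tensor P).gr m ∧
        ∀ (q₁ q₂ : Q.carrier) (p₁ p₂ : P.carrier),
          m (Q.tmul P q₁ p₁) (Q.tmul P q₂ p₂) = Q.tmul P (op (C.μ.pairing p₁ q₂) • q₁) p₂)) := by
  let M := C.toMoritaPairing hμ hν
  exact ⟨⟨fun N => M.φ.generates N.obj, fun N => M.op.φ.generates N.obj,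
      fun N => M.ψ.generates N.obj, fun N => M.op.ψ.generates N.obj⟩,
    ⟨M.swap.rightCanonicalIso hA, (M.op.rightCanonicalIso hA.op).leftCanonicalIso,
      (M.swap.op.rightCanonicalIso hB.op).leftCanonicalIso, M.rightCanonicalIso hB⟩,
    M.areInverseGradedEquivalences,
    ⟨⟨M.swap.tensorIsoHOM, M.swap.tensorIsoHOM_apply⟩,
      ⟨M.tensorIsoHOM, M.tensorIsoHOM_apply⟩⟩,
    ⟨⟨⟨M.dualIso hQ.1 hA, M.dualIso_apply hQ.1 hA⟩,
        ⟨M.tensorRegularIso hQ.1 hA, M.tensorRegularIso_apply hQ.1 hA⟩⟩,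
      ⟨⟨M.op.dualIso hQ.2 hB.op, M.op.dualIso_apply hQ.2 hB.op⟩,
        ⟨M.op.tensorRegularIso hQ.2 hB.op,
          fun q b => M.op.tensorRegularIso_apply hQ.2 hB.op q (op b)⟩⟩,
      ⟨⟨M.swap.dualIso hP.1 hB, M.swap.dualIso_apply hP.1 hB⟩,
        ⟨M.swap.tensorRegularIso hP.1 hB, M.swap.tensorRegularIso_apply hP.1 hB⟩⟩,
      ⟨⟨M.swap.op.dualIso hP.2 hA.op, M.swap.op.dualIso_apply hP.2 hA.op⟩,
        ⟨M.swap.op.tensorRegularIso hP.2 hA.op,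
          fun p a => M.swap.op.tensorRegularIso_apply hP.2 hA.op p (op a)⟩⟩⟩,
    ⟨⟨C.μ.mul, C.μ.mul_isGradedRingMul, C.mul_tmul_tmul⟩,
      ⟨C.ν.mul, C.ν.mul_isGradedRingMul, C.mul_tmul_tmul'⟩⟩⟩
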